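/- **Setting.** A probabilistic transition system (PTS) $A=(S,\Sigma,\to,s_0)$ has states $S$ with initial state $s_0$, actions $\Sigma$, and a transition relation ${\to}\subseteq S\times\Sigma\times\mathcal D(S)$, where $\mathcal D(S)$ is the set of probability distributions on $S$; at least one transition leaves every state. Let $A=(S,\Sigma,\to,s_0)$ be a PTS (nominal model) and $A'=(S',\Sigma\uplus\mathcal F,\to',s'_0)$ a PTS (implementation), $\mathcal F$ being a set of fault labels disjoint from $\Sigma$. For $R\subseteq S\times S'$ write $\mu\,R^{\#}\mu'$ if there is a distribution on $S\times S'$ with marginals $\mu,\mu'$ and support contained in $R$. Then $A\preceq_m A'$ means that there is a relation $M\subseteq S\times S'$ with $s_0\,M\,s_0'$ such that whenever $s\,M\,s'$, $e\in\Sigma$ and $F\in\mathcal F$: (1) if $s\xrightarrow{e}\mu$, then $s'\xrightarrow{e}{}'\mu'$ and $\mu\,M^{\#}\mu'$ for some $\mu'$; (2) if $s'\xrightarrow{e}{}'\mu'$, then $s\xrightarrow{e}\mu$ and $\mu\,M^{\#}\mu'$ for some $\mu$; (3) if $s'\xrightarrow{F}{}'\mu'$, then $\Delta_s\,M^{\#}\mu'$,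 where $\Delta_s$ is the Dirac distribution. **Symbolic game graph.** Its vertices are: the Refuter's vertices $(s,s')\in S\times S'$ and $v_{\rm err}$; the Verifier's vertices $(s,\sigma^1,s',\mu)$ with $s\xrightarrow{\sigma}\mu$ and $(s,\sigma^2,s',\mu')$ with $s'\xrightarrow{\sigma}{}'\mu'$; the probabilistic vertices $(s,s',\mu,\mu')$ with $\mu\in\mathcal D(S)$, $\mu'\in\mathcal D(S')$. Its edges are: from $(s,s')$ to all $(s,\sigma^1,s',\mu)$ and $(s,\sigma^2,s',\mu')$; from $(s,\sigma^1,s',\mu)$ to $(s,s',\mu,\mu')$ whenever $s'\xrightarrow{\sigma}{}'\mu'$; from $(s,\sigma^2,s',\mu')$ with $\sigma\in\Sigma$ to $(s,s',\mu,\mu')$ whenever $s\xrightarrow{\sigma}\mu$; from $(s,F^2,s',\mu')$ with $F\in\mathcal F$ to $(s,s',\Delta_s,\mu')$; from $(s,s',\mu,\mu')$ to $(t,t')$ whenever $\mu(t)>0$ and $\mu'(t')>0$; and from $v_{\rm err}$, and from each Verifier's vertex without any other successor, to $v_{\rm err}$. $\mathrm{Post}(v)$ is the set of successors of $v$. For a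 probabilistic vertex $v=(s,s',\mu,\mu')$ and a set $C$ of vertices, $\mathrm{Eq}(v,C)$ is the linear system in the unknowns $x_{t,t'}\ge 0$ ($t\in\mathrm{Supp}\,\mu$, $t'\in\mathrm{Supp}\,\mu'$) with $\sum_{t'}x_{t,t'}=\mu(t)$ for every $t$, $\sum_t x_{t,t'}=\mu'(t')$ for every $t'$, and $\sum_{(t,t')\in C}x_{t,t'}=0$. Let $U^0=\{v_{\rm err}\}$. Let $U^{i+1}$ consist of the Refuter's vertices $v$ with $\mathrm{Post}(v)\cap U^i\neq\emptyset$, the Verifier's vertices $v$ with $\mathrm{Post}(v)\subseteq\bigcup_{j\le i}U^j$ and $\mathrm{Post}(v)\cap U^i\ne\emptyset$, and the probabilistic vertices $v$ with $\mathrm{Post}(v)\cap U^i\neq\emptyset$ for which $\mathrm{Eq}(v,\mathrm{Post}(v)\cap U^i)$ has no solution. Put $U=\bigcup_{i\ge0}U^i$. **Theorem.** There are two programs and a polynomial $P$ such that for all finite PTSs $A$, $A'$ as above with rational probabilities, states and labels being numbered and each PTS being given by its number of states, its initial state and the list of its transitions (each with source, label, and support with probabilities, integers in binary): 1. the first program,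 on input $(A,A')$, decides whether $A\preceq_m A'$ in time at most $P(m\cdot m')$; 2. the second program, on input $(A,A')$, lists exactly the pairs $(s,s')\in S\times S'$ whose Refuter's vertex belongs to $U$, in time at most $P(m\cdot m')$; 3. $A\preceq_m A'$ if and only if $(s_0,s_0')\notin U$. Here $m$ and $m'$ are the sizes (numbers of bits) of the lists of transitions of $A$ and $A'$. Programs are built by composition, pairing, branching and while loops from elementary operations on binary trees with integer leaves, and the running time counts each elementary operation with the number of bits that it reads and writes; this is multitape Turing machine time up to a polynomial. -/

import Mathlib

namespace PMask

/-! ## Probabilistic transition systems and probabilistic masking simulation -/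

/-- A probabilistic transition system with states `S` and actions `Act`.  `PMF S` is the type of
discrete probability distributions on `S`; some transition leaves every state. -/
structure PTS (S Act : Type) where
  trans : S → Act → PMF S → Prop
  init : S
  serial : ∀ s, ∃ a μ, trans s a μ

/-- `w` is a coupling for `(μ, μ')`: its marginals are `μ` and `μ'`. -/
def IsCoupling {S S' : Type} (w : PMF (S × S')) (μ : PMF S) (μ' : PMF S') : Prop :=
  w.map Prod.fst = μ ∧ w.map Prod.snd = μ'

/-- The lifting `R^#` of a relation to distributions: some coupling has its support inside `R`. -/
def LiftRel {S S' : Type} (R : S → S' → Prop) (μ : PMF S) (μ' : PMF S') : Prop :=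
  ∃ w : PMF (S × S'), IsCoupling w μ μ' ∧ ∀ q ∈ w.support, R q.1 q.2

/-- The actions of the implementation are `Sig ⊕ Flt`, the disjoint union of the ordinary actions
and the fault labels. -/
structure IsMaskingSimulation {S S' Sig Flt : Type} (A : PTS S Sig) (A' : PTS S' (Sig ⊕ Flt))
    (M : S → S' → Prop) : Prop where
  init : M A.init A'.init
  nominal : ∀ s s', M s s' → ∀ (e : Sig) (μ : PMF S), A.trans s e μ →
    ∃ μ', A'.trans s' (Sum.inl e) μ' ∧ LiftRel M μ μ'
  implementation : ∀ s s', M s s' → ∀ (e : Sig) (μ' : PMF S'), A'.trans s' (Sum.inl e) μ' →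
    ∃ μ, A.trans s e μ ∧ LiftRel M μ μ'
  fault : ∀ s s', M s s' → ∀ (F : Flt) (μ' : PMF S'), A'.trans s' (Sum.inr F) μ' →
    LiftRel M (PMF.pure s) μ'

/-- `A ⪯_m A'`: the implementation `A'` is strong probabilistic masking fault-tolerant with
respect to the nominal model `A`. -/
def MaskingLE {S S' Sig Flt : Type} (A : PTS S Sig) (A' : PTS S' (Sig ⊕ Flt)) : Prop :=
  ∃ M : S → S' → Prop, IsMaskingSimulation A A' M

/-! ## The symbolic game graph and the set `U` -/

/-- The tuples from which the vertices of the symbolic game graph are taken.  The superscripts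
`1` and `2` on actions, telling which model the Refuter has moved, are the constructors `ver₁` and
`ver₂`. -/
inductive SymVertex (S S' Sig Flt : Type) where
  | err
  | ref (s : S) (s' : S')
  | ver₁ (s : S) (σ : Sig) (s' : S') (μ : PMF S)
  | ver₂ (s : S) (σ : Sig ⊕ Flt) (s' : S') (μ' : PMF S')
  | prob (s : S) (s' : S') (μ : PMF S) (μ' : PMF S')

section SymbolicGame

variable {S S' Sig Flt : Type} (A : PTS S Sig) (A' : PTS S' (Sig ⊕ Flt))

/-- The Refuter's vertices. -/
def refuterVertices : Set (SymVertex S S' Sig Flt) :=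
  {v | v = .err ∨ ∃ s s', v = .ref s s'}

/-- The Verifier's vertices. -/
def verifierVertices : Set (SymVertex S S' Sig Flt) :=
  {v | (∃ s σ s' μ, A.trans s σ μ ∧ v = .ver₁ s σ s' μ) ∨
    ∃ s σ s' μ', A'.trans s' σ μ' ∧ v = .ver₂ s σ s' μ'}

/-- The edges of the symbolic game graph, except those into the error vertex. -/
inductive SymMove : SymVertex S S' Sig Flt → SymVertex S S' Sig Flt → Prop
  | refute₁ {s s' σ μ} : A.trans s σ μ → SymMove (.ref s s') (.ver₁ s σ s' μ)
  | refute₂ {s s' σ μ'} : A'.trans s' σ μ' → SymMove (.ref s s') (.ver₂ s σ s' μ')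
  | verify₁ {s s' σ μ μ'} : A.trans s σ μ → A'.trans s' (Sum.inl σ) μ' →
      SymMove (.ver₁ s σ s' μ) (.prob s s' μ μ')
  | verify₂ {s s' σ μ μ'} : A'.trans s' (Sum.inl σ) μ' → A.trans s σ μ →
      SymMove (.ver₂ s (Sum.inl σ) s' μ') (.prob s s' μ μ')
  | mask {s s' F μ'} : A'.trans s' (Sum.inr F) μ' →
      SymMove (.ver₂ s (Sum.inr F) s' μ') (.prob s s' (PMF.pure s) μ')
  | draw {s s' μ μ' t t'} : t ∈ μ.support → t' ∈ μ'.support →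
      SymMove (.prob s s' μ μ') (.ref t t')

/-- The successors of a vertex.  A Verifier's vertex without any other successor, and the error
vertex itself, have an edge to the error vertex. -/
def symPost (v : SymVertex S S' Sig Flt) : Set (SymVertex S S' Sig Flt) :=
  {u | SymMove A A' v u ∨
    (u = .err ∧ (v ∈ verifierVertices A A' ∨ v = .err) ∧ ¬ ∃ u', u' ≠ .err ∧ SymMove A A' v u')}

/-- `x` solves the transportation system `Eq(v, C)` of the probabilistic vertex
`v = (s, -, s', μ, μ', P)`: one nonnegative variable for each pair in `Supp μ × Supp μ'`, row sums
`μ`, column sums `μ'`, and the sum of the variables of the pairs that belong to `C` is `0`. -/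
structure SolvesEq (μ : PMF S) (μ' : PMF S') (C : Set (SymVertex S S' Sig Flt))
    (x : μ.support → μ'.support → ℝ) : Prop where
  nonneg : ∀ k j, 0 ≤ x k j
  row : ∀ k : μ.support, HasSum (fun j => x k j) (μ k).toReal
  col : ∀ j : μ'.support, HasSum (fun k => x k j) (μ' j).toReal
  avoid : HasSum (fun q : {q : μ.support × μ'.support //
    SymVertex.ref (q.1 : S) (q.2 : S') ∈ C} => x q.1.1 q.1.2) 0

/-- The sets `U^i`. -/
def symU : ℕ → Set (SymVertex S S' Sig Flt)
  | 0 => {.err}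
  | i + 1 =>
    {v | v ∈ refuterVertices ∧ (symPost A A' v ∩ symU i).Nonempty} ∪
    {v | v ∈ verifierVertices A A' ∧ (symPost A A' v ⊆ ⋃ j : Fin (i + 1), symU j.1) ∧
      (symPost A A' v ∩ symU i).Nonempty} ∪
    {v | ∃ s s' μ μ', v = .prob s s' μ μ' ∧ (symPost A A' v ∩ symU i).Nonempty ∧
      ¬ ∃ x, SolvesEq μ μ' (symPost A A' v ∩ symU i) x}
  termination_by i => i
  decreasing_by
    all_goals omega

/-- The set `U`, the union of all `U^i`. -/
def symUSet : Set (SymVertex S S' Sig Flt) := ⋃ i, symU A A' i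

end SymbolicGame

/-! ## A machine model with a running time

Programs work on binary trees whose leaves are integers written in binary.  Every elementary
operation is charged the number of bits it reads and writes, so that running times agree with those
of multitape Turing machines up to a polynomial. -/

/-- The data of the machine. -/
inductive Val where
  | num (z : ℤ)
  | pair (a b : Val)

namespace Val

/-- The number of bits of a datum: the binary length of the integers, plus one for each node. -/
def size : Val → ℕ
  | num z => z.natAbs.size + 1
  | pair a b => a.size + b.size + 1

/-- Truth values are `1` and `0`. -/
def ofBool (b : Bool) : Val := num (if b then 1 else 0)

/-- Lists are nested pairs that end in `0`. -/
def ofList : List Val → Val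
  | [] => num 0
  | x :: l => pair x (ofList l)

end Val

/-- The elementary operations. -/
inductive Prim where
  | id | const (z : ℤ) | fst | snd | isPair | add | sub | mul | le

/-- The effect of an elementary operation; it is `0` on an argument of the wrong form. -/
def Prim.eval : Prim → Val → Val
  | .id, v => v
  | .const z, _ => .num z
  | .fst, .pair a _ => a
  | .snd, .pair _ b => b
  | .isPair, .pair _ _ => .ofBool true
  | .add, .pair (.num a) (.num b) => .num (a + b)
  | .sub, .pair (.num a) (.num b) => .num (a - b)
  | .mul, .pair (.num a) (.num b) => .num (a * b)
  | .le, .pair (.num a) (.num b) => .ofBool (decide (a ≤ b))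
  | _, _ => .num 0

/-- Programs.  A test succeeds if its value differs from `0`. -/
inductive Code where
  | prim (o : Prim)
  | comp (g f : Code)
  | pair (f g : Code)
  | ite (c f g : Code)
  | loop (c f : Code)

/-- `Run p x y t`: the program `p`, started on `x`, halts with output `y` after `t` steps. -/
inductive Code.Run : Code → Val → Val → ℕ → Prop
  | prim (o : Prim) (x : Val) :
      Run (.prim o) x (o.eval x) (x.size + (o.eval x).size + 1)
  | comp {g f x y z t₁ t₂} : Run f x y t₁ → Run g y z t₂ → Run (.comp g f) x z (t₁ + t₂ + 1)
  | pair {f g x y z t₁ t₂} : Run f x y t₁ → Run g x z t₂ →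
      Run (.pair f g) x (.pair y z) (t₁ + t₂ + x.size + (Val.pair y z).size + 1)
  | ite_true {c f g x b y t₁ t₂} : Run c x b t₁ → b ≠ .num 0 → Run f x y t₂ →
      Run (.ite c f g) x y (t₁ + t₂ + x.size + 1)
  | ite_false {c f g x y t₁ t₂} : Run c x (.num 0) t₁ → Run g x y t₂ →
      Run (.ite c f g) x y (t₁ + t₂ + x.size + 1)
  | loop_true {c f x b y z t₁ t₂ t₃} : Run c x b t₁ → b ≠ .num 0 → Run f x y t₂ →
      Run (.loop c f) y z t₃ → Run (.loop c f) x z (t₁ + t₂ + t₃ + x.size + 1)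
  | loop_false {c f x t₁} : Run c x (.num 0) t₁ → Run (.loop c f) x x (t₁ + x.size + 1)

/-- Programs are deterministic: input determines output and running time. -/
theorem Code.Run.unique {p : Code} {x y y' : Val} {t t' : ℕ} (h : p.Run x y t)
    (h' : p.Run x y' t') : y = y' ∧ t = t' := by
  induction h generalizing y' t' with
  | prim o x => cases h'; exact ⟨rfl, rfl⟩
  | comp _ _ ih₁ ih₂ =>
    cases h' with
    | comp k₁ k₂ =>
      obtain ⟨rfl, rfl⟩ := ih₁ k₁
      obtain ⟨rfl, rfl⟩ := ih₂ k₂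
      exact ⟨rfl, rfl⟩
  | pair _ _ ih₁ ih₂ =>
    cases h' with
    | pair k₁ k₂ =>
      obtain ⟨rfl, rfl⟩ := ih₁ k₁
      obtain ⟨rfl, rfl⟩ := ih₂ k₂
      exact ⟨rfl, rfl⟩
  | ite_true _ hb _ ih₁ ih₂ =>
    cases h' with
    | ite_true k₁ _ k₂ =>
      obtain ⟨rfl, rfl⟩ := ih₁ k₁
      obtain ⟨rfl, rfl⟩ := ih₂ k₂
      exact ⟨rfl, rfl⟩
    | ite_false k₁ _ => exact absurd (ih₁ k₁).1 hb
  | ite_false _ _ ih₁ ih₂ =>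
    cases h' with
    | ite_true k₁ kb _ => exact absurd (ih₁ k₁).1.symm kb
    | ite_false k₁ k₂ =>
      obtain ⟨_, rfl⟩ := ih₁ k₁
      obtain ⟨rfl, rfl⟩ := ih₂ k₂
      exact ⟨rfl, rfl⟩
  | loop_true _ hb _ _ ih₁ ih₂ ih₃ =>
    cases h' with
    | loop_true k₁ _ k₂ k₃ =>
      obtain ⟨rfl, rfl⟩ := ih₁ k₁
      obtain ⟨rfl, rfl⟩ := ih₂ k₂
      obtain ⟨rfl, rfl⟩ := ih₃ k₃
      exact ⟨rfl, rfl⟩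
    | loop_false k₁ => exact absurd (ih₁ k₁).1 hb
  | loop_false _ ih₁ =>
    cases h' with
    | loop_true k₁ kb _ _ => exact absurd (ih₁ k₁).1.symm kb
    | loop_false k₁ =>
      obtain ⟨_, rfl⟩ := ih₁ k₁
      exact ⟨rfl, rfl⟩

/-! ## Finite transition systems as inputs of programs -/

/-- A probability distribution on `{0, …, n - 1}` with rational values. -/
structure RatDist (n : ℕ) where
  p : Fin n → ℚ
  nonneg : ∀ i, 0 ≤ p i
  sum_eq_one : ∑ i, p i = 1

/-- The distribution itself. -/
noncomputable def RatDist.toPMF {n : ℕ} (d : RatDist n) : PMF (Fin n) :=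
  PMF.ofFintype (fun i => ENNReal.ofReal (d.p i : ℝ)) (by
    rw [← ENNReal.ofReal_sum_of_nonneg (fun i _ => by exact_mod_cast d.nonneg i),
      ← Rat.cast_sum, d.sum_eq_one, Rat.cast_one, ENNReal.ofReal_one])

/-- A distribution is written as the list of the points of its support, each with the numerator and
the denominator of its probability. -/
def RatDist.encode {n : ℕ} (d : RatDist n) : Val :=
  .ofList (((List.finRange n).filter (fun i => d.p i ≠ 0)).map fun (i : Fin n) =>
    .pair (.num (i : ℕ)) (.pair (.num (d.p i).num) (.num (d.p i).den)))

/-- A finite probabilistic transition system with states `{0, …, n - 1}`, given by the list of its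
transitions, all of them with rational probabilities. -/
structure FinPTS (L : Type) where
  n : ℕ
  init : Fin n
  trans : List (Fin n × L × RatDist n)
  serial : ∀ s, ∃ τ ∈ trans, τ.1 = s

namespace FinPTS

variable {L : Type}

/-- The probabilistic transition system that is described. -/
noncomputable def toPTS (D : FinPTS L) : PTS (Fin D.n) L where
  trans s a μ := ∃ d : RatDist D.n, (s, a, d) ∈ D.trans ∧ μ = d.toPMF
  init := D.init
  serial s := by
    obtain ⟨⟨s', a, d⟩, h, rfl⟩ := D.serial s
    exact ⟨a, _, d, h, rfl⟩

/-- The list of the transitions, written down with the labels in the form `lab`. -/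
def encodeTrans (lab : L → Val) (D : FinPTS L) : Val :=
  .ofList (D.trans.map fun τ =>
    .pair (.num (τ.1 : ℕ)) (.pair (lab τ.2.1) τ.2.2.encode))

/-- The whole system: number of states, initial state, transitions. -/
def encode (lab : L → Val) (D : FinPTS L) : Val :=
  .pair (.num D.n) (.pair (.num (D.init : ℕ)) (D.encodeTrans lab))

/-- The size of the transitions: the number of bits of the list of the transitions. -/
def transSize (lab : L → Val) (D : FinPTS L) : ℕ := (D.encodeTrans lab).size

end FinPTS

/-- Actions are numbered. -/
def actionVal (a : ℕ) : Val := .num a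

/-- Actions and fault labels are numbered and carry a mark that tells them apart. -/
def labelVal : ℕ ⊕ ℕ → Val
  | .inl a => .pair (.num 0) (.num a)
  | .inr F => .pair (.num 1) (.num F)

/-- The input that presents a nominal model and an implementation to a program. -/
def inputVal (A : FinPTS ℕ) (A' : FinPTS (ℕ ⊕ ℕ)) : Val :=
  .pair (A.encode actionVal) (A'.encode labelVal)

/-- A list of pairs of states, as an output of a program. -/
def pairsVal {n n' : ℕ} (l : List (Fin n × Fin n')) : Val :=
  .ofList (l.map fun q => .pair (.num (q.1 : ℕ)) (.num (q.2 : ℕ)))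

end PMask

namespace PMask

/-! ## Polynomial time on encoded data -/

/-! Both `symU` and masking simulation describe one greatest fixed point. Call a relation closed if
`Simulates` holds at each of its pairs. From the pairs of a closed relation the Verifier can answer
every move inside it, so no stage of `symU` meets the safe vertices (`not_mem_symU_of_safe`).
Conversely, the stages increase and the systems branch finitely, so whatever is forced into
`symUSet` enters at a finite stage; hence the state pairs outside `symUSet` form a closed relation
(`simulates_of_ref_not_mem`). Together this is `ref_not_mem_symUSet_iff`.

The greatest closed relation is computed by starting from all pairs and deleting those at which a
condition fails. There are at most as many effective rounds as pairs (`refineRel_winning`,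
`relOf_winning_iff`).

Each test asks for a coupling supported in the current relation. After multiplication by all
denominators this is an integer transportation problem (`feasible_network_iff`), solved by maximum
flow with capacity scaling. A phase with step `d` leaves less than `d` per node between the flow and
some cut (`augmentPhase_spec`), so `2 * (number of nodes)` augmentations suffice in the next phase.
At `d = 1` the flow equals a cut, and max-flow min-cut gives `feasible_iff`.

For the running time, `PolyTime` is closed under the operations in use. The one danger is a loop
whose data grow exponentially, so loops need a bound on all intermediate values: paths are short
(`SmallSearch`), flows grow additively (`esize_augment_le`), relations only shrink. Seriality bounds
the number of states by the number of transitions, so the input is polynomial in the product of the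
transition sizes (`esize_input_le`). -/

/-- Types whose elements are written as data of the machine. -/
class Enc (α : Type) where
  enc : α → Val

open Enc

section PolyTime

variable {α β γ δ : Type} [Enc α] [Enc β] [Enc γ] [Enc δ]

instance : Enc ℤ := ⟨.num⟩
instance : Enc Bool := ⟨.ofBool⟩
instance : Enc (α × β) := ⟨fun p => .pair (enc p.1) (enc p.2)⟩
instance : Enc (List α) := ⟨fun l => .ofList (l.map enc)⟩

/-- The number of bits of the encoding. -/
def esize (a : α) : ℕ := (enc a).size

theorem enc_bool (b : Bool) : enc b = .ofBool b := rfl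
theorem enc_nil : enc ([] : List α) = .num 0 := rfl
theorem enc_cons (a : α) (l : List α) : enc (a :: l) = .pair (enc a) (enc l) := rfl

theorem esize_int (z : ℤ) : esize z = z.natAbs.size + 1 := rfl
theorem esize_prod (p : α × β) : esize p = esize p.1 + esize p.2 + 1 := rfl
theorem esize_mk (a : α) (b : β) : esize (a, b) = esize a + esize b + 1 := rfl
theorem esize_nil : esize ([] : List α) = 1 := rfl
theorem esize_cons (a : α) (l : List α) : esize (a :: l) = esize a + esize l + 1 := rfl

theorem Val.size_pos (v : Val) : 0 < v.size := by
  cases v <;> simp [Val.size]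

theorem esize_pos (a : α) : 0 < esize a := Val.size_pos _

theorem esize_bool (b : Bool) : esize b ≤ 2 := by
  cases b <;> simp [esize, enc_bool, Val.ofBool, Val.size]

theorem esize_le_of_mem {a : α} {l : List α} (h : a ∈ l) : esize a ≤ esize l := by
  induction l with
  | nil => simp at h
  | cons b l ih =>
    rw [esize_cons]
    rcases List.mem_cons.1 h with rfl | h
    · omega
    · have := ih h
      omega

theorem esize_append (l l' : List α) : esize (l ++ l') + 1 = esize l + esize l' := by
  induction l with
  | nil => simp [esize_nil]; omega
  | cons b l ih => simp only [List.cons_append, esize_cons]; omega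

theorem length_le_esize (l : List α) : l.length ≤ esize l := by
  induction l with
  | nil => simp
  | cons b l ih => simp only [List.length_cons, esize_cons]; omega

theorem esize_list_le {l : List α} {n c : ℕ} (hn : l.length ≤ n) (h : ∀ a ∈ l, esize a ≤ c) :
    esize l ≤ n * (c + 1) + 1 := by
  induction l generalizing n with
  | nil => simp [esize_nil]
  | cons b l ih =>
    obtain ⟨m, rfl⟩ : ∃ m, n = m + 1 := ⟨n - 1, by simp at hn; omega⟩
    have h₁ := ih (n := m) (by simpa using hn) fun a ha => h a (List.mem_cons_of_mem _ ha)
    have h₂ := h b List.mem_cons_self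
    rw [esize_cons]
    linarith [add_mul m 1 (c + 1)]

theorem esize_le_of_sublist {l l' : List α} (h : l.Sublist l') : esize l ≤ esize l' := by
  induction h with
  | slnil => exact le_rfl
  | cons a _ ih => rw [esize_cons]; omega
  | cons_cons a _ ih => rw [esize_cons, esize_cons]; omega

theorem size_le_of_le_add {a b c : ℕ} (h : c ≤ a + b) : c.size ≤ a.size + b.size + 1 := by
  rw [Nat.size_le, pow_succ]
  have h₁ := Nat.lt_size_self a
  have h₂ := Nat.lt_size_self b
  have h₃ : 2 ^ a.size ≤ 2 ^ (a.size + b.size) := Nat.pow_le_pow_right (by omega) (by omega)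
  have h₄ : 2 ^ b.size ≤ 2 ^ (a.size + b.size) := Nat.pow_le_pow_right (by omega) (by omega)
  omega

theorem esize_add_le (a b : ℤ) : esize (a + b) ≤ esize a + esize b := by
  have := size_le_of_le_add (Int.natAbs_add_le a b)
  rw [esize_int, esize_int, esize_int]
  omega

theorem esize_sub_le (a b : ℤ) : esize (a - b) ≤ esize a + esize b := by
  have := size_le_of_le_add (Int.natAbs_sub_le a b)
  rw [esize_int, esize_int, esize_int]
  omega

theorem esize_mul_le (a b : ℤ) : esize (a * b) ≤ esize a + esize b := by
  rw [esize_int, esize_int, esize_int]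
  have : (a * b).natAbs.size ≤ a.natAbs.size + b.natAbs.size := by
    rw [Nat.size_le, pow_add, Int.natAbs_mul]
    exact Nat.mul_lt_mul'' (Nat.lt_size_self _) (Nat.lt_size_self _)
  omega

/-! ### Polynomial bounds and closure properties of polynomial time -/

/-- A quantity that is bounded by a polynomial in the size of the argument. -/
def PolyBounded (φ : α → ℕ) : Prop := ∃ k : ℕ, ∀ x, φ x ≤ (esize x + 2) ^ k

namespace PolyBounded

variable {φ ψ : α → ℕ}

protected theorem mono (h : PolyBounded ψ) (hle : ∀ x, φ x ≤ ψ x) : PolyBounded φ :=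
  h.imp fun _ hk x => (hle x).trans (hk x)

/-- The base `esize x + 2` is at least `2`, so a single power absorbs constants: `c < 2 ^ c`. -/
protected theorem const (c : ℕ) : PolyBounded fun _ : α => c :=
  ⟨c, fun _ => (Nat.lt_two_pow_self).le.trans (Nat.pow_le_pow_left (by omega) _)⟩

protected theorem esize : PolyBounded fun x : α => esize x := ⟨1, fun x => by simp⟩

protected theorem mul (h : PolyBounded φ) (h' : PolyBounded ψ) :
    PolyBounded fun x => φ x * ψ x := by
  obtain ⟨k, hk⟩ := h
  obtain ⟨l, hl⟩ := h'
  exact ⟨k + l, fun x => by rw [pow_add]; exact Nat.mul_le_mul (hk x) (hl x)⟩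

protected theorem add (h : PolyBounded φ) (h' : PolyBounded ψ) :
    PolyBounded fun x => φ x + ψ x := by
  obtain ⟨k, hk⟩ := h
  obtain ⟨l, hl⟩ := h'
  refine ⟨k + l + 1, fun x => ?_⟩
  set b := esize x + 2
  have hb : 2 ≤ b := by omega
  have h₁ : b ^ k ≤ b ^ (k + l) := Nat.pow_le_pow_right (by omega) (by omega)
  have h₂ : b ^ l ≤ b ^ (k + l) := Nat.pow_le_pow_right (by omega) (by omega)
  have h₃ : φ x ≤ b ^ k := hk x
  have h₄ : ψ x ≤ b ^ l := hl x
  calc φ x + ψ x ≤ b ^ (k + l) * 2 := by omega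
    _ ≤ b ^ (k + l) * b := Nat.mul_le_mul le_rfl hb
    _ = b ^ (k + l + 1) := (pow_succ _ _).symm

protected theorem comp {φ : β → ℕ} (h : PolyBounded φ) {f : α → β}
    (hf : PolyBounded fun x => esize (f x)) : PolyBounded fun x => φ (f x) := by
  obtain ⟨k, hk⟩ := h
  obtain ⟨l, hl⟩ := hf.add (.const 2)
  refine ⟨l * k, fun x => (hk _).trans ?_⟩
  rw [pow_mul]
  exact Nat.pow_le_pow_left (hl x) _

end PolyBounded

/-- Some program computes `f` on encodings in polynomial time. -/
def PolyTime (f : α → β) : Prop :=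
  ∃ (c : Code) (φ : α → ℕ), PolyBounded φ ∧ ∀ x, ∃ t ≤ φ x, c.Run (enc x) (enc (f x)) t

/-- Written bits are charged. Time bounds are therefore also bounds on outputs, which is what
composition needs. -/
theorem Code.Run.size_le {c : Code} {x y : Val} {t : ℕ} (h : c.Run x y t) : y.size ≤ t := by
  induction h <;> omega

namespace PolyTime

protected theorem esize {f : α → β} (hf : PolyTime f) : PolyBounded fun x => esize (f x) := by
  obtain ⟨c, φ, hφ, h⟩ := hf
  refine hφ.mono fun x => ?_
  obtain ⟨t, ht, hr⟩ := h x
  exact hr.size_le.trans ht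

theorem bound_comp {f : α → β} (hf : PolyTime f) {φ : β → ℕ} (hφ : PolyBounded φ) :
    PolyBounded fun x => φ (f x) := hφ.comp hf.esize

theorem of_prim (o : Prim) {f : α → β} (h : ∀ x, o.eval (enc x) = enc (f x)) {φ : α → ℕ}
    (hφ : PolyBounded φ) (hs : ∀ x, esize (f x) ≤ φ x) : PolyTime f := by
  refine ⟨.prim o, _, (PolyBounded.esize.add hφ).add (.const 1), fun x =>
    ⟨(enc x).size + (o.eval (enc x)).size + 1, ?_, h x ▸ .prim o _⟩⟩
  have := hs x
  rw [h x]
  change (enc x).size + esize (f x) + 1 ≤ esize x + φ x + 1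
  change (enc x).size + _ + 1 ≤ (enc x).size + _ + 1
  omega

protected theorem id : PolyTime fun x : α => x :=
  of_prim .id (fun _ => rfl) .esize fun _ => le_rfl

protected theorem const (b : β) : PolyTime fun _ : α => b := by
  -- The constant is assembled along its tree, and each node reads the input once; hence time linear
  -- in `x.size`.
  have key : ∀ v : Val, ∃ (c : Code) (k : ℕ), ∀ x : Val, ∃ t ≤ k * x.size, c.Run x v t := by
    intro v
    induction v with
    | num z =>
      refine ⟨.prim (.const z), (Val.num z).size + 2, fun x => ⟨_, ?_, .prim _ _⟩⟩
      have := x.size_pos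
      change x.size + (Val.num z).size + 1 ≤ _
      nlinarith
    | pair v w hv hw =>
      obtain ⟨c, k, hc⟩ := hv
      obtain ⟨d, l, hd⟩ := hw
      refine ⟨.pair c d, k + l + (Val.pair v w).size + 2, fun x => ?_⟩
      obtain ⟨t, ht, hr⟩ := hc x
      obtain ⟨t', ht', hr'⟩ := hd x
      refine ⟨_, ?_, .pair hr hr'⟩
      have := x.size_pos
      nlinarith
  obtain ⟨c, k, h⟩ := key (enc b)
  exact ⟨c, _, (PolyBounded.const k).mul .esize, fun x => h _⟩

protected theorem comp {g : β → γ} {f : α → β} (hg : PolyTime g) (hf : PolyTime f) :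
    PolyTime fun x => g (f x) := by
  have hb := hf.esize
  obtain ⟨c, φ, hφ, h⟩ := hf
  obtain ⟨d, ψ, hψ, h'⟩ := hg
  refine ⟨.comp d c, _, (hφ.add (hψ.comp hb)).add (.const 1), fun x => ?_⟩
  obtain ⟨t, ht, hr⟩ := h x
  obtain ⟨t', ht', hr'⟩ := h' (f x)
  exact ⟨_, by omega, .comp hr hr'⟩

theorem mk {f : α → β} {g : α → γ} (hf : PolyTime f) (hg : PolyTime g) :
    PolyTime fun x => (f x, g x) := by
  have hb := hf.esize
  have hb' := hg.esize
  obtain ⟨c, φ, hφ, h⟩ := hf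
  obtain ⟨d, ψ, hψ, h'⟩ := hg
  refine ⟨.pair c d, _, (((hφ.add hψ).add .esize).add ((hb.add hb').add (.const 1))).add (.const 1),
    fun x => ?_⟩
  obtain ⟨t, ht, hr⟩ := h x
  obtain ⟨t', ht', hr'⟩ := h' x
  refine ⟨_, ?_, .pair hr hr'⟩
  change t + t' + esize x + (esize (f x) + esize (g x) + 1) + 1 ≤ _
  omega

theorem fst {f : α → β × γ} (hf : PolyTime f) : PolyTime fun x => (f x).1 :=
  (of_prim (f := fun p : β × γ => p.1) .fst (fun _ => rfl) .esize
    fun p => by rw [esize_prod]; omega).comp hf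

theorem snd {f : α → β × γ} (hf : PolyTime f) : PolyTime fun x => (f x).2 :=
  (of_prim (f := fun p : β × γ => p.2) .snd (fun _ => rfl) .esize
    fun p => by rw [esize_prod]; omega).comp hf

protected theorem add {f g : α → ℤ} (hf : PolyTime f) (hg : PolyTime g) :
    PolyTime fun x => f x + g x :=
  (of_prim (f := fun p : ℤ × ℤ => p.1 + p.2) .add (fun _ => rfl) .esize
    fun p => by have := esize_add_le p.1 p.2; rw [esize_prod]; omega).comp (hf.mk hg)

protected theorem sub {f g : α → ℤ} (hf : PolyTime f) (hg : PolyTime g) :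
    PolyTime fun x => f x - g x :=
  (of_prim (f := fun p : ℤ × ℤ => p.1 - p.2) .sub (fun _ => rfl) .esize
    fun p => by have := esize_sub_le p.1 p.2; rw [esize_prod]; omega).comp (hf.mk hg)

protected theorem mul {f g : α → ℤ} (hf : PolyTime f) (hg : PolyTime g) :
    PolyTime fun x => f x * g x :=
  (of_prim (f := fun p : ℤ × ℤ => p.1 * p.2) .mul (fun _ => rfl) .esize
    fun p => by have := esize_mul_le p.1 p.2; rw [esize_prod]; omega).comp (hf.mk hg)

protected theorem le {f g : α → ℤ} (hf : PolyTime f) (hg : PolyTime g) :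
    PolyTime fun x => decide (f x ≤ g x) :=
  (of_prim (f := fun p : ℤ × ℤ => decide (p.1 ≤ p.2)) .le (fun _ => rfl) (.const 2)
    fun _ => esize_bool _).comp (hf.mk hg)

/-- A nonempty list has the same encoding as the pair of its head and tail. -/
theorem cons {f : α → β} {g : α → List β} (hf : PolyTime f) (hg : PolyTime g) :
    PolyTime fun x => f x :: g x := hf.mk hg

protected theorem ite {c : α → Bool} {f g : α → β} (hc : PolyTime c) (hf : PolyTime f)
    (hg : PolyTime g) : PolyTime fun x => if c x then f x else g x := by
  obtain ⟨c', τ, hτ, hc⟩ := hc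
  obtain ⟨f', φ, hφ, hf⟩ := hf
  obtain ⟨g', ψ, hψ, hg⟩ := hg
  refine ⟨.ite c' f' g', _, (((hτ.add hφ).add hψ).add .esize).add (.const 1), fun x => ?_⟩
  obtain ⟨t, ht, hr⟩ := hc x
  obtain ⟨t', ht', hr'⟩ := hf x
  obtain ⟨t'', ht'', hr''⟩ := hg x
  have hx : esize x = (enc x).size := rfl
  cases h : c x with
  | true =>
    rw [h] at hr
    simp only [h, if_true]
    exact ⟨t + t' + (enc x).size + 1, by omega,
      .ite_true hr (by simp [enc_bool, Val.ofBool]) hr'⟩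
  | false =>
    rw [h] at hr
    simp only [h, Bool.false_eq_true, if_false]
    exact ⟨t + t'' + (enc x).size + 1, by omega, .ite_false hr hr''⟩

protected theorem not {f : α → Bool} (hf : PolyTime f) : PolyTime fun x => !f x := by
  convert PolyTime.ite hf (.const false) (.const true) using 2 with x
  cases f x <;> rfl

protected theorem and {f g : α → Bool} (hf : PolyTime f) (hg : PolyTime g) :
    PolyTime fun x => f x && g x := by
  convert PolyTime.ite hf hg (.const false) using 2 with x
  cases f x <;> rfl

protected theorem or {f g : α → Bool} (hf : PolyTime f) (hg : PolyTime g) :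
    PolyTime fun x => f x || g x := by
  convert PolyTime.ite hf (.const true) hg using 2 with x
  cases f x <;> rfl

protected theorem eq {f g : α → ℤ} (hf : PolyTime f) (hg : PolyTime g) :
    PolyTime fun x => decide (f x = g x) := by
  convert (hf.le hg).and (hg.le hf) using 2 with x
  rw [← Bool.decide_and]
  exact decide_eq_decide.2 le_antisymm_iff

/-- Case distinction on a list. -/
theorem uncons {f : α × List β → γ} {g : α → γ} {h : α × β × List β → γ} (hg : PolyTime g)
    (hh : PolyTime h) (h₁ : ∀ x, f (x, []) = g x) (h₂ : ∀ x a l, f (x, a :: l) = h (x, a, l)) :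
    PolyTime f := by
  have hb : PolyTime fun p : α × List β => decide (p.2 ≠ []) :=
    (of_prim (f := fun l : List β => decide (l ≠ [])) .isPair
      (fun l => by cases l <;> simp [enc_nil, enc_cons, enc_bool, Prim.eval, Val.ofBool])
      (.const 2) fun _ => esize_bool _).comp (snd .id)
  have hg' : PolyTime fun p : α × List β => g p.1 := hg.comp (fst .id)
  obtain ⟨c', τ, hτ, hc⟩ := hb
  obtain ⟨f', φ, hφ, hf⟩ := hg'
  obtain ⟨g', ψ, hψ, hg⟩ := hh
  -- `(x, a :: l)` and `(x, a, l)` have the same encoding, so the program for `h` runs on the list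
  -- as it stands. `θ` is its time bound, with the value `0` on empty lists, where it is not used.
  obtain ⟨θ, hθ⟩ : ∃ θ : α × List β → ℕ, θ = fun p => p.2.recOn 0 fun a l _ => ψ (p.1, a, l) :=
    ⟨_, rfl⟩
  have hψ' : PolyBounded θ := by
    obtain ⟨k, hk⟩ := hψ
    refine ⟨k, fun ⟨x, l⟩ => ?_⟩
    subst hθ
    cases l with
    | nil => simp
    | cons a l => exact hk (x, a, l)
  refine ⟨.ite c' g' f', _, (((hτ.add hφ).add hψ').add .esize).add (.const 1), fun ⟨x, l⟩ => ?_⟩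
  obtain ⟨t, ht, hr⟩ := hc (x, l)
  obtain ⟨t', ht', hr'⟩ := hf (x, l)
  have hx : esize (x, l) = (enc (x, l)).size := rfl
  cases l with
  | nil =>
    rw [h₁ x]
    exact ⟨t + t' + (enc (x, ([] : List β))).size + 1, by omega, .ite_false hr hr'⟩
  | cons a l =>
    obtain ⟨t'', ht'', hr''⟩ := hg (x, a, l)
    have : θ (x, a :: l) = ψ (x, a, l) := by subst hθ; rfl
    rw [h₂ x a l]
    exact ⟨t + t'' + (enc (x, a :: l)).size + 1, by omega,
      .ite_true hr (by simp [enc_bool, Val.ofBool]) hr''⟩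

/-- Loops with polynomially many rounds on data of polynomial size. -/
theorem iterate {c : β → Bool} {f : β → β} {i : α → β} (hc : PolyTime c) (hf : PolyTime f)
    (hi : PolyTime i) {n φ : α → ℕ} (hn : PolyBounded n) (hφ : PolyBounded φ)
    (hs : ∀ x, ∀ k ≤ n x, esize (f^[k] (i x)) ≤ φ x)
    (h₁ : ∀ x, ∀ k < n x, c (f^[k] (i x)) = true) (h₂ : ∀ x, c (f^[n x] (i x)) = false) :
    PolyTime fun x => f^[n x] (i x) := by
  obtain ⟨c', τ, ⟨d, hτ⟩, hc⟩ := hc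
  obtain ⟨f', ψ, ⟨e, hψ⟩, hf⟩ := hf
  obtain ⟨i', ρ, hρ, hi⟩ := hi
  have hpow : ∀ d : ℕ, PolyBounded fun x => (φ x + 2) ^ d := by
    intro d
    induction d with
    | zero => simpa using PolyBounded.const 1
    | succ d ih => simpa only [pow_succ] using ih.mul (hφ.add (.const 2))
  refine ⟨.comp (.loop c' f') i', _, (hρ.add ((hn.add (.const 1)).mul
    (((hpow d).add (hpow e)).add (hφ.add (.const 1))))).add (.const 1), fun x => ?_⟩
  -- Every state has size at most `φ x`, so `T` covers the test, the body and the reading of the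
  -- state in one round. With `m` rounds to go, the final failing test makes it `m + 1`.
  set T := (φ x + 2) ^ d + (φ x + 2) ^ e + (φ x + 1) with hT
  have key : ∀ m k, k + m = n x → ∃ t ≤ (m + 1) * T,
      (Code.loop c' f').Run (enc (f^[k] (i x))) (enc (f^[n x] (i x))) t := by
    intro m
    induction m with
    | zero =>
      intro k hk
      obtain rfl : k = n x := by omega
      have hk := hs x _ le_rfl
      obtain ⟨t, ht, hr⟩ := hc (f^[n x] (i x))
      have : t ≤ (φ x + 2) ^ d := ht.trans ((hτ _).trans (Nat.pow_le_pow_left (by omega) _))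
      have hx : esize (f^[n x] (i x)) = (enc (f^[n x] (i x))).size := rfl
      rw [h₂ x] at hr
      exact ⟨t + (enc (f^[n x] (i x))).size + 1, by omega, .loop_false hr⟩
    | succ m ih =>
      intro k hk
      have hk' := hs x k (by omega)
      obtain ⟨t, ht, hr⟩ := hc (f^[k] (i x))
      obtain ⟨t', ht', hr'⟩ := hf (f^[k] (i x))
      obtain ⟨t'', ht'', hr''⟩ := ih (k + 1) (by omega)
      have h₃ : t ≤ (φ x + 2) ^ d := ht.trans ((hτ _).trans (Nat.pow_le_pow_left (by omega) _))
      have h₄ : t' ≤ (φ x + 2) ^ e := ht'.trans ((hψ _).trans (Nat.pow_le_pow_left (by omega) _))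
      rw [h₁ x k (by omega)] at hr
      rw [← Function.iterate_succ_apply' f] at hr'
      refine ⟨_, ?_, .loop_true hr (by simp [enc_bool, Val.ofBool]) hr' hr''⟩
      have hx : esize (f^[k] (i x)) = (enc (f^[k] (i x))).size := rfl
      rw [add_mul (m + 1) 1 T]
      omega
  obtain ⟨t, ht, hr⟩ := hi x
  obtain ⟨t', ht', hr'⟩ := key (n x) 0 (by omega)
  exact ⟨t + t' + 1, by omega, .comp hr hr'⟩

end PolyTime
end PolyTime

/-! ### Folds and the usual list operations in polynomial time -/

section PolyTimeList

variable {α β γ σ : Type} [Enc α] [Enc β] [Enc γ] [Enc σ]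

namespace PolyTime

/-- The loop state holds the argument, the accumulator and the unread rest of the list. The bound
`hs` on all partial folds is indispensable: a polynomial step such as squaring, iterated along a
list, can produce exponentially long data. -/
protected theorem foldl {l : α → List β} {i : α → σ} {g : α → σ → β → σ} (hl : PolyTime l)
    (hi : PolyTime i) (hg : PolyTime fun p : α × σ × β => g p.1 p.2.1 p.2.2) {φ : α → ℕ}
    (hφ : PolyBounded φ)
    (hs : ∀ x p q, l x = p ++ q → esize (p.foldl (g x) (i x)) ≤ φ x) :
    PolyTime fun x => (l x).foldl (g x) (i x) := by
  let c : (α × σ) × List β → Bool := fun p => !p.2.isEmpty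
  let f : (α × σ) × List β → (α × σ) × List β := fun p =>
    p.2.casesOn p fun a t => ((p.1.1, g p.1.1 p.1.2 a), t)
  have hc : PolyTime c := uncons (.const false) (.const true) (fun _ => rfl) (fun _ _ _ => rfl)
  have hf : PolyTime f := uncons (PolyTime.id.mk (.const [])) (((fst (fst .id)).mk (hg.comp
    ((fst (fst .id)).mk ((snd (fst .id)).mk (fst (snd .id)))))).mk (snd (snd .id)))
    (fun _ => rfl) (fun _ _ _ => rfl)
  have key : ∀ x s k (l : List β), k ≤ l.length →
      f^[k] ((x, s), l) = ((x, (l.take k).foldl (g x) s), l.drop k) := by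
    intro x s k
    induction k generalizing s with
    | zero => intro l _; rfl
    | succ k ih =>
      rintro (_ | ⟨a, l⟩) h
      · simp at h
      · rw [Function.iterate_succ_apply, List.take_succ_cons, List.drop_succ_cons,
          List.foldl_cons]
        exact ih _ l (by simpa using h)
  have := iterate hc hf ((PolyTime.id.mk hi).mk hl) (n := fun x => (l x).length)
    (φ := fun x => esize x + φ x + esize (l x) + 2)
    (hl.esize.mono fun x => length_le_esize _)
    (((PolyBounded.esize.add hφ).add hl.esize).add (.const 2)) ?_ ?_ ?_
  · convert snd (fst this) using 2 with x
    rw [key _ _ _ _ le_rfl, List.take_length]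
  · intro x k hk
    rw [key _ _ _ _ hk, esize_mk, esize_mk]
    have h₁ := hs x ((l x).take k) ((l x).drop k) (List.take_append_drop _ _).symm
    have h₂ := esize_le_of_sublist (List.drop_sublist k (l x))
    omega
  · intro x k hk
    rw [key _ _ _ _ hk.le]
    simpa [c] using hk
  · intro x
    rw [key _ _ _ _ le_rfl]
    simp [c]

/-- A step that adds at most `φ x` bits makes the accumulator grow by at most `esize (l x) * φ x` in
all. -/
theorem foldl_of_additive {l : α → List β} {i : α → σ} {g : α → σ → β → σ} (hl : PolyTime l)
    (hi : PolyTime i) (hg : PolyTime fun p : α × σ × β => g p.1 p.2.1 p.2.2) {φ : α → ℕ}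
    (hφ : PolyBounded φ) (hs : ∀ x s, ∀ a ∈ l x, esize (g x s a) ≤ esize s + φ x) :
    PolyTime fun x => (l x).foldl (g x) (i x) := by
  refine .foldl hl hi hg (hi.esize.add (hl.esize.mul hφ)) fun x p q h => ?_
  have key : ∀ (p : List β) s, (∀ a ∈ p, a ∈ l x) →
      esize (p.foldl (g x) s) ≤ esize s + p.length * φ x := by
    intro p
    induction p with
    | nil => simp
    | cons a p ih =>
      intro s hp
      have h₁ := ih (g x s a) fun b hb => hp b (List.mem_cons_of_mem _ hb)
      have h₂ := hs x s a (hp a List.mem_cons_self)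
      rw [List.length_cons, add_mul, List.foldl_cons]
      omega
  refine (key p _ fun a ha => by rw [h]; exact List.mem_append_left _ ha).trans ?_
  have h₁ := length_le_esize (l x)
  have h₂ : p.length ≤ (l x).length := by rw [h, List.length_append]; omega
  exact Nat.add_le_add_left (Nat.mul_le_mul_right _ (h₂.trans h₁)) _

protected theorem reverse {l : α → List β} (hl : PolyTime l) : PolyTime fun x => (l x).reverse := by
  have := foldl_of_additive (g := fun _ s a => a :: s) hl (.const [])
    ((snd (snd .id)).cons (fst (snd .id))) (hl.esize.add (.const 1)) fun x s a ha => by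
      have := esize_le_of_mem ha
      rw [esize_cons]
      omega
  convert this using 2 with x
  rw [List.foldl_flip_cons_eq_append']
  simp

protected theorem append {l l' : α → List β} (hl : PolyTime l) (hl' : PolyTime l') :
    PolyTime fun x => l x ++ l' x := by
  have := foldl_of_additive (g := fun _ s a => a :: s) hl.reverse hl'
    ((snd (snd .id)).cons (fst (snd .id))) (hl.esize.add (.const 1)) fun x s a ha => by
      have := esize_le_of_mem (List.mem_reverse.1 ha)
      rw [esize_cons]
      omega
  convert this using 2 with x
  rw [List.foldl_flip_cons_eq_append']
  simp

/-- Entries of `l x` are no longer than `l x`, so a bound that depends on an entry can be made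
uniform over the list. -/
theorem bound_bind {l : α → List β} (hl : PolyTime l) {φ : α × β → ℕ} (hφ : PolyBounded φ) :
    ∃ ψ : α → ℕ, PolyBounded ψ ∧ ∀ x, ∀ a ∈ l x, φ (x, a) ≤ ψ x := by
  obtain ⟨k, hk⟩ := hφ
  have h : PolyBounded fun x => (esize (l x) + esize x + 3) := (hl.esize.add .esize).add (.const 3)
  refine ⟨fun x => (esize (l x) + esize x + 3) ^ k, ?_, fun x a ha => (hk _).trans ?_⟩
  · clear hk; induction k with
    | zero => simpa using PolyBounded.const 1
    | succ k ih => simpa only [pow_succ] using ih.mul h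
  · refine Nat.pow_le_pow_left ?_ _
    have := esize_le_of_mem ha
    rw [esize_mk]
    omega

protected theorem flatMap {l : α → List β} {g : α → β → List γ} (hl : PolyTime l)
    (hg : PolyTime fun p : α × β => g p.1 p.2) : PolyTime fun x => (l x).flatMap (g x) := by
  obtain ⟨ψ, hψ, h⟩ := bound_bind hl hg.esize
  have := foldl_of_additive (g := fun x s a => s ++ g x a) hl (.const [])
    ((fst (snd .id)).append (hg.comp ((fst .id).mk (snd (snd .id))))) hψ fun x s a ha => by
      have h₁ := h x a ha
      have h₂ := esize_append s (g x a)
      have h₃ : esize (g (x, a).1 (x, a).2) = esize (g x a) := rfl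
      omega
  convert this using 2 with x
  have key : ∀ (l : List β) s, l.foldl (fun s a => s ++ g x a) s = s ++ l.flatMap (g x) := by
    intro l
    induction l with
    | nil => simp
    | cons a l ih => intro s; simp [ih]
  rw [key, List.nil_append]

protected theorem map {l : α → List β} {g : α → β → γ} (hl : PolyTime l)
    (hg : PolyTime fun p : α × β => g p.1 p.2) : PolyTime fun x => (l x).map (g x) := by
  convert PolyTime.flatMap (g := fun x a => [g x a]) hl (hg.cons (.const [])) using 2 with x
  exact List.map_eq_flatMap

protected theorem filter {l : α → List β} {g : α → β → Bool} (hl : PolyTime l)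
    (hg : PolyTime fun p : α × β => g p.1 p.2) : PolyTime fun x => (l x).filter (g x) := by
  convert PolyTime.flatMap (g := fun x a => if g x a then [a] else []) hl
    (hg.ite ((snd .id).cons (.const [])) (.const [])) using 2 with x
  induction l x with
  | nil => rfl
  | cons a l ih =>
    rw [List.filter_cons, List.flatMap_cons, ← ih]
    split <;> simp

protected theorem any {l : α → List β} {g : α → β → Bool} (hl : PolyTime l)
    (hg : PolyTime fun p : α × β => g p.1 p.2) : PolyTime fun x => (l x).any (g x) := by
  have := foldl_of_additive (g := fun x s a => s || g x a) hl (.const false)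
    ((fst (snd .id)).or (hg.comp ((fst .id).mk (snd (snd .id))))) (.const 2) fun x s a _ => by
      have := esize_bool (s || g x a)
      omega
  convert this using 2 with x
  have key : ∀ (l : List β) s, l.foldl (fun s a => s || g x a) s = (s || l.any (g x)) := by
    intro l
    induction l with
    | nil => simp
    | cons a l ih => intro s; simp [ih, Bool.or_assoc]
  rw [key, Bool.false_or]

protected theorem all {l : α → List β} {g : α → β → Bool} (hl : PolyTime l)
    (hg : PolyTime fun p : α × β => g p.1 p.2) : PolyTime fun x => (l x).all (g x) := by
  convert (PolyTime.any (g := fun x a => !g x a) hl hg.not).not using 2 with x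
  rw [List.not_any_eq_all_not]
  simp

protected theorem sum {l : α → List ℤ} (hl : PolyTime l) : PolyTime fun x => (l x).sum := by
  have := foldl_of_additive (g := fun _ s a => s + a) hl (.const 0)
    ((fst (snd .id)).add (snd (snd .id))) hl.esize fun x s a ha => by
      have := esize_le_of_mem ha
      have := esize_add_le s a
      omega
  convert this using 2 with x
  exact List.sum_eq_foldl

/-- Bit lengths add under multiplication, so the product too grows additively. -/
protected theorem prod {l : α → List ℤ} (hl : PolyTime l) : PolyTime fun x => (l x).prod := by
  have := foldl_of_additive (g := fun _ s a => s * a) hl (.const 1)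
    ((fst (snd .id)).mul (snd (snd .id))) hl.esize fun x s a ha => by
      have := esize_le_of_mem ha
      have := esize_mul_le s a
      omega
  convert this using 2 with x
  exact List.prod_eq_foldl

theorem take_one {l : α → List β} (hl : PolyTime l) : PolyTime fun x => (l x).take 1 :=
  (uncons (α := ℤ) (f := fun p : ℤ × List β => p.2.take 1) (.const [])
    ((fst (snd .id)).cons (.const [])) (fun _ => rfl) (fun _ _ _ => rfl))
    |>.comp ((PolyTime.const 0).mk hl)

/-- The product of two lists. -/
protected theorem product {l : α → List β} {l' : α → List γ} (hl : PolyTime l) (hl' : PolyTime l') :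
    PolyTime fun x => l x ×ˢ l' x :=
  PolyTime.flatMap (g := fun x a => (l' x).map (Prod.mk a)) hl
    (PolyTime.map (g := fun p b => (p.2, b)) (hl'.comp (fst .id)) ((snd (fst .id)).mk (snd .id)))

end PolyTime
end PolyTimeList

/-! ## Transportation problems over the integers -/

/-- A list of pushes: source, target, amount. -/
abbrev Pushes := List (ℤ × ℤ × ℤ)

/-- A transportation problem: the supplies, the demands, and the pairs along which one may
transport. -/
abbrev Network := List (ℤ × ℤ) × List (ℤ × ℤ) × List (ℤ × ℤ)

/-- The amount that leaves `i`. -/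
def outflow (f : Pushes) (i : ℤ) : ℤ := ((f.filter fun e => e.1 = i).map fun e => e.2.2).sum

/-- The amount that arrives at `j`. -/
def inflow (f : Pushes) (j : ℤ) : ℤ := ((f.filter fun e => e.2.1 = j).map fun e => e.2.2).sum

/-- The amount that is sent from `i` to `j`. -/
def flow (f : Pushes) (i j : ℤ) : ℤ :=
  ((f.filter fun e => e.1 = i && e.2.1 = j).map fun e => e.2.2).sum

def total (f : Pushes) : ℤ := (f.map fun e => e.2.2).sum

def memPair (W : List (ℤ × ℤ)) (i j : ℤ) : Bool := W.any fun q => q.1 = i && q.2 = j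

/-- The sources that can send `d` more units, or can be relieved of `d` units by a source in `R`;
each comes with the pushes that lead to it. -/
def candidates (N : Network) (f : Pushes) (d : ℤ) (R : List (ℤ × Pushes)) : List (ℤ × Pushes) :=
  ((N.1.filter fun r => outflow f r.1 + d ≤ r.2).map fun r => (r.1, [])) ++
  R.flatMap fun e => (N.2.1.filter fun c => memPair N.2.2 e.1 c.1).flatMap fun c =>
    (N.1.filter fun r => d ≤ flow f r.1 c.1).map fun r =>
      (r.1, (e.1, c.1, d) :: (r.1, c.1, -d) :: e.2)

/-- Add one new candidate, if there is one. -/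
def grow (N : Network) (f : Pushes) (d : ℤ) (R : List (ℤ × Pushes)) : List (ℤ × Pushes) :=
  ((candidates N f d R).filter fun e => !(R.any fun e' => e'.1 = e.1)).take 1 ++ R

/-- A round adds at most one source, never one already present, so one round for each source
exhausts the search (`mem_reached_of_mem_candidates`). -/
def reached (N : Network) (f : Pushes) (d : ℤ) : List (ℤ × Pushes) :=
  N.1.foldl (fun R _ => grow N f d R) []

/-- The augmenting paths that have been found. -/
def augmentations (N : Network) (f : Pushes) (d : ℤ) : List Pushes :=
  (reached N f d).flatMap fun e =>
    (N.2.1.filter fun c => memPair N.2.2 e.1 c.1 && inflow f c.1 + d ≤ c.2).map fun c =>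
      (e.1, c.1, d) :: e.2

/-- A flow is a log of pushes, negative ones included, so augmenting is concatenation. The flow
stays as it is when no path has been found. -/
def augment (N : Network) (f : Pushes) (d : ℤ) : Pushes :=
  ((augmentations N f d).take 1).flatMap (fun p => p) ++ f

def nodes (N : Network) : List (ℤ × ℤ) := N.1 ++ N.2.1

/-- Twice as many augmentations as there are nodes. -/
def augmentPhase (N : Network) (f : Pushes) (d : ℤ) : Pushes :=
  (nodes N ++ nodes N).foldl (fun f _ => augment N f d) f

def supply (N : Network) : ℤ := (N.1.map fun r => r.2).sum

/-- The powers of two up to the first that exceeds `b`, in decreasing order. -/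
def powersUpTo (b : ℤ) : List ℤ := ((List.range (b.toNat.size + 1)).map fun k => 2 ^ k).reverse

/-- Capacity scaling: the number of phases is the bit length of the supply, whereas augmenting by
units only could take exponentially many steps. -/
def maxFlow (N : Network) : Pushes :=
  (powersUpTo (supply N)).foldl (fun f d => augmentPhase N f d) []

def feasible (N : Network) : Bool := supply N = total (maxFlow N)

/-! ### Polynomial time of the flow algorithm -/

section PolyTimeFlow

variable {α : Type} [Enc α]

namespace PolyTime

protected theorem neg {f : α → ℤ} (hf : PolyTime f) : PolyTime fun x => -f x := by
  simpa using PolyTime.sub (.const 0) hf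

theorem outflow {f : α → Pushes} {i : α → ℤ} (hf : PolyTime f) (hi : PolyTime i) :
    PolyTime fun x => outflow (f x) (i x) := by
  -- For a tuple of arguments each argument is a projection, and the closure properties can be
  -- applied along the formula.
  have h : PolyTime fun p : Pushes × ℤ => PMask.outflow p.1 p.2 := by
    unfold PMask.outflow
    repeat' with_reducible first
        | apply PolyTime.id | apply PolyTime.fst | apply PolyTime.snd | apply PolyTime.sum
        | apply PolyTime.map | apply PolyTime.filter | apply PolyTime.eq
  exact (h.comp (hf.mk hi) :)

theorem inflow {f : α → Pushes} {i : α → ℤ} (hf : PolyTime f) (hi : PolyTime i) :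
    PolyTime fun x => inflow (f x) (i x) := by
  have h : PolyTime fun p : Pushes × ℤ => PMask.inflow p.1 p.2 := by
    unfold PMask.inflow
    repeat' with_reducible first
        | apply PolyTime.id | apply PolyTime.fst | apply PolyTime.snd | apply PolyTime.sum
        | apply PolyTime.map | apply PolyTime.filter | apply PolyTime.eq
  exact (h.comp (hf.mk hi) :)

theorem flow {f : α → Pushes} {i j : α → ℤ} (hf : PolyTime f) (hi : PolyTime i)
    (hj : PolyTime j) : PolyTime fun x => flow (f x) (i x) (j x) := by
  have h : PolyTime fun p : Pushes × ℤ × ℤ => PMask.flow p.1 p.2.1 p.2.2 := by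
    unfold PMask.flow
    repeat' with_reducible first
        | apply PolyTime.id | apply PolyTime.fst | apply PolyTime.snd | apply PolyTime.sum
        | apply PolyTime.map | apply PolyTime.filter | apply PolyTime.eq | apply PolyTime.and
  exact (h.comp (hf.mk (hi.mk hj)) :)

theorem memPair {W : α → List (ℤ × ℤ)} {i j : α → ℤ} (hW : PolyTime W) (hi : PolyTime i)
    (hj : PolyTime j) : PolyTime fun x => memPair (W x) (i x) (j x) := by
  have h : PolyTime fun p : List (ℤ × ℤ) × ℤ × ℤ => PMask.memPair p.1 p.2.1 p.2.2 := by
    unfold PMask.memPair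
    repeat' with_reducible first
        | apply PolyTime.id | apply PolyTime.fst | apply PolyTime.snd | apply PolyTime.any
        | apply PolyTime.eq | apply PolyTime.and
  exact (h.comp (hW.mk (hi.mk hj)) :)

theorem candidates {N : α → Network} {f : α → Pushes} {d : α → ℤ} {R : α → List (ℤ × Pushes)}
    (hN : PolyTime N) (hf : PolyTime f) (hd : PolyTime d) (hR : PolyTime R) :
    PolyTime fun x => candidates (N x) (f x) (d x) (R x) := by
  have h : PolyTime fun p : Network × Pushes × ℤ × List (ℤ × Pushes) =>
      PMask.candidates p.1 p.2.1 p.2.2.1 p.2.2.2 := by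
    unfold PMask.candidates
    repeat' with_reducible first
        | apply PolyTime.id | apply PolyTime.const | apply PolyTime.fst | apply PolyTime.snd
        | apply PolyTime.flatMap | apply PolyTime.map | apply PolyTime.filter
        | apply PolyTime.append | apply PolyTime.add | apply PolyTime.le | apply PolyTime.outflow
        | apply PolyTime.flow | apply PolyTime.cons | apply PolyTime.mk | apply PolyTime.neg
        | apply PolyTime.memPair
  exact (h.comp (hN.mk (hf.mk (hd.mk hR))) :)

theorem grow {N : α → Network} {f : α → Pushes} {d : α → ℤ} {R : α → List (ℤ × Pushes)}
    (hN : PolyTime N) (hf : PolyTime f) (hd : PolyTime d) (hR : PolyTime R) :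
    PolyTime fun x => grow (N x) (f x) (d x) (R x) := by
  have h : PolyTime fun p : Network × Pushes × ℤ × List (ℤ × Pushes) =>
      PMask.grow p.1 p.2.1 p.2.2.1 p.2.2.2 := by
    unfold PMask.grow
    repeat' with_reducible first
        | apply PolyTime.id | apply PolyTime.fst | apply PolyTime.snd | apply PolyTime.filter
        | apply PolyTime.append | apply PolyTime.eq | apply PolyTime.any | apply PolyTime.not
        | apply PolyTime.candidates | apply PolyTime.take_one
  exact (h.comp (hN.mk (hf.mk (hd.mk hR))) :)

end PolyTime

/-- The pushes in a search state are few and small. -/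
def SmallSearch (N : Network) (d : ℤ) (k : ℕ) (R : List (ℤ × Pushes)) : Prop :=
  R.length ≤ k ∧ ∀ e ∈ R, e.1 ∈ N.1.map Prod.fst ∧ e.2.length ≤ 2 * k ∧
    ∀ a ∈ e.2, esize a ≤ 2 * esize N + esize d + 2

theorem esize_neg (d : ℤ) : esize (-d) = esize d := by
  rw [esize_int, esize_int, Int.natAbs_neg]

theorem esize_fst_le {l : List (ℤ × ℤ)} {r : ℤ × ℤ} (h : r ∈ l) : esize r.1 ≤ esize l := by
  have := esize_le_of_mem h
  rw [esize_prod] at this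
  omega

theorem esize_push_le {N : Network} {i : ℤ} {c : ℤ × ℤ} (hi : i ∈ N.1.map Prod.fst)
    (hc : c ∈ N.2.1) (d : ℤ) : esize (i, c.1, d) ≤ 2 * esize N + esize d + 2 := by
  obtain ⟨r, hr, rfl⟩ := List.mem_map.1 hi
  have h₁ := esize_fst_le hr
  have h₂ := esize_fst_le hc
  rw [esize_mk, esize_mk, esize_prod N, esize_prod N.2]
  omega

/-- A new candidate extends an old path by two pushes of `d` or `-d` between nodes of `N`. Paths
thus grow linearly with the rounds, and single pushes do not grow at all. -/
theorem SmallSearch.grow {N : Network} {d : ℤ} {k : ℕ} {R : List (ℤ × Pushes)}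
    (h : SmallSearch N d k R) (f : Pushes) : SmallSearch N d (k + 1) (grow N f d R) := by
  obtain ⟨hl, hR⟩ := h
  refine ⟨?_, fun e he => ?_⟩
  · have := List.length_take_le 1
      ((candidates N f d R).filter fun e => !(R.any fun e' => e'.1 = e.1))
    rw [PMask.grow, List.length_append]
    omega
  · rw [PMask.grow, List.mem_append] at he
    rcases he with he | he
    · have he := (List.mem_filter.1 (List.mem_of_mem_take he)).1
      simp only [candidates, List.mem_append, List.mem_map, List.mem_flatMap,
        List.mem_filter] at he
      rcases he with ⟨r, ⟨hr, -⟩, rfl⟩ | ⟨e', he', c, ⟨hc, -⟩, r, ⟨hr, -⟩, rfl⟩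
      · exact ⟨List.mem_map_of_mem hr, by simp, by simp⟩
      · obtain ⟨h₁, h₂, h₃⟩ := hR e' he'
        refine ⟨List.mem_map_of_mem hr, by simp only [List.length_cons]; omega, ?_⟩
        intro a ha
        rcases List.mem_cons.1 ha with rfl | ha
        · exact esize_push_le h₁ hc d
        rcases List.mem_cons.1 ha with rfl | ha
        · rw [← esize_neg d]
          exact esize_push_le (List.mem_map_of_mem hr) hc (-d)
        · exact h₃ a ha
    · obtain ⟨h₁, h₂, h₃⟩ := hR e he
      exact ⟨h₁, by omega, h₃⟩

theorem SmallSearch.foldl {N : Network} {d : ℤ} (f : Pushes) {β : Type} (l : List β) :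
    SmallSearch N d l.length (l.foldl (fun R _ => PMask.grow N f d R) []) := by
  induction l using List.reverseRecOn with
  | nil => exact ⟨by simp, by simp⟩
  | append_singleton l a ih =>
    rw [List.foldl_append, List.length_append]
    exact ih.grow f

theorem SmallSearch.esize_le {N : Network} {d : ℤ} {k : ℕ} {R : List (ℤ × Pushes)}
    (h : SmallSearch N d k R) :
    esize R ≤ k * (esize N + (2 * k * (2 * esize N + esize d + 3) + 1) + 1 + 1) + 1 := by
  refine esize_list_le h.1 fun e he => ?_
  obtain ⟨h₁, h₂, h₃⟩ := h.2 e he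
  obtain ⟨r, hr, h₁⟩ := List.mem_map.1 h₁
  have h₄ := esize_list_le h₂ h₃
  change esize e.2 ≤ 2 * k * (2 * esize N + esize d + 3) + 1 at h₄
  have h₅ := esize_fst_le hr
  rw [h₁] at h₅
  rw [esize_prod e]
  have : esize N.1 ≤ esize N := by rw [esize_prod N]; omega
  omega

/-- A bound for the size of an augmenting path. -/
def augmentationBound (N : Network) (d : ℤ) : ℕ :=
  (2 * esize N + 1) * (2 * esize N + esize d + 3) + 1

theorem esize_augmentation_le {N : Network} {f : Pushes} {d : ℤ} {p : Pushes}
    (hp : p ∈ augmentations N f d) : esize p ≤ augmentationBound N d := by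
  simp only [augmentations, List.mem_map, List.mem_flatMap, List.mem_filter] at hp
  obtain ⟨e, he, c, ⟨hc, -⟩, rfl⟩ := hp
  obtain ⟨h₁, h₂, h₃⟩ := (SmallSearch.foldl f N.1).2 e he
  have h₄ := length_le_esize N.1
  have h₅ := esize_prod N
  -- Two pushes for each round of the search and one final push: hence the factor `2 * esize N + 1`.
  refine esize_list_le (by rw [List.length_cons]; omega) fun a ha => ?_
  rcases List.mem_cons.1 ha with rfl | ha
  · exact esize_push_le h₁ hc d
  · exact h₃ a ha

/-- The increase does not depend on `f`, so repeated augmentation is a fold with additive growth. -/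
theorem esize_augment_le (N : Network) (f : Pushes) (d : ℤ) :
    esize (augment N f d) ≤ esize f + augmentationBound N d := by
  rw [augment]
  rcases h : augmentations N f d with _ | ⟨p, l⟩
  · simp
  · have h₁ := esize_augmentation_le (h ▸ List.mem_cons_self : p ∈ augmentations N f d)
    have h₂ := esize_append p f
    simp only [List.take_succ_cons, List.take_zero, List.flatMap_cons, List.flatMap_nil,
      List.append_nil]
    omega

theorem esize_foldl_augment_le (N : Network) (d : ℤ) {β : Type} (l : List β) (f : Pushes) :
    esize (l.foldl (fun f _ => augment N f d) f) ≤ esize f + l.length * augmentationBound N d := by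
  induction l generalizing f with
  | nil => simp
  | cons a l ih =>
    have h₁ := ih (augment N f d)
    have h₂ := esize_augment_le N f d
    rw [List.foldl_cons, List.length_cons, add_mul]
    omega

theorem polyBounded_augmentationBound :
    PolyBounded fun p : Network × ℤ => augmentationBound p.1 p.2 := by
  have h₁ : PolyBounded fun p : Network × ℤ => esize p.1 := (PolyTime.fst .id).esize
  have h₂ : PolyBounded fun p : Network × ℤ => esize p.2 := (PolyTime.snd .id).esize
  exact ((((PolyBounded.const 2).mul h₁).add (.const 1)).mul
    ((((PolyBounded.const 2).mul h₁).add h₂).add (.const 3))).add (.const 1)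

namespace PolyTime

theorem reached {N : α → Network} {f : α → Pushes} {d : α → ℤ}
    (hN : PolyTime N) (hf : PolyTime f) (hd : PolyTime d) :
    PolyTime fun x => reached (N x) (f x) (d x) := by
  have hk := hN.fst.esize
  have hN' := hN.esize
  -- The bound is that of `SmallSearch.esize_le`, with `k` replaced by `esize (N x).1`.
  refine PolyTime.foldl (g := fun x R _ => PMask.grow (N x) (f x) (d x) R) hN.fst (.const [])
    (grow (hN.comp (fst .id)) (hf.comp (fst .id)) (hd.comp (fst .id)) (fst (snd .id)))
    ((hk.mul (((hN'.add ((((PolyBounded.const 2).mul hk).mul ((((PolyBounded.const 2).mul hN').add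
      hd.esize).add (.const 3))).add (.const 1))).add (.const 1)).add (.const 1))).add (.const 1))
    fun x p q h => ?_
  have h₁ := (SmallSearch.foldl (N := N x) (d := d x) (f x) p).esize_le
  have h₂ : p.length ≤ esize (N x).1 := by
    refine le_trans ?_ (length_le_esize _)
    rw [h, List.length_append]
    omega
  refine h₁.trans ?_
  gcongr

theorem augment {N : α → Network} {f : α → Pushes} {d : α → ℤ}
    (hN : PolyTime N) (hf : PolyTime f) (hd : PolyTime d) :
    PolyTime fun x => augment (N x) (f x) (d x) := by
  have h : PolyTime fun p : Network × Pushes × ℤ => PMask.augment p.1 p.2.1 p.2.2 := by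
    unfold PMask.augment augmentations
    repeat' with_reducible first
        | apply PolyTime.id | apply PolyTime.fst | apply PolyTime.snd | apply PolyTime.flatMap
        | apply PolyTime.map | apply PolyTime.filter | apply PolyTime.append | apply PolyTime.add
        | apply PolyTime.le | apply PolyTime.and | apply PolyTime.inflow | apply PolyTime.cons
        | apply PolyTime.mk | apply PolyTime.memPair | apply PolyTime.reached
        | apply PolyTime.take_one
  exact (h.comp (hN.mk (hf.mk hd)) :)

theorem augmentPhase {N : α → Network} {f : α → Pushes} {d : α → ℤ}
    (hN : PolyTime N) (hf : PolyTime f) (hd : PolyTime d) :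
    PolyTime fun x => augmentPhase (N x) (f x) (d x) := by
  have hn : PolyTime fun x => nodes (N x) := hN.fst.append hN.snd.fst
  refine foldl_of_additive (g := fun x f _ => PMask.augment (N x) f (d x)) (hn.append hn) hf
    (augment (hN.comp (fst .id)) (fst (snd .id)) (hd.comp (fst .id)))
    (polyBounded_augmentationBound.comp (hN.mk hd).esize) fun x f _ _ => esize_augment_le _ _ _

theorem supply {N : α → Network} (hN : PolyTime N) : PolyTime fun x => supply (N x) :=
  .sum (PolyTime.map (g := fun _ r => r.2) hN.fst (snd (snd .id)))

theorem powersUpTo {b : α → ℤ} (hb : PolyTime b) : PolyTime fun x => powersUpTo (b x) := by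
  have hsize : PolyBounded fun b : ℤ => b.toNat.size := by
    refine PolyBounded.esize.mono fun b => ?_
    rw [esize_int]
    have := Nat.size_le_size (show b.toNat ≤ b.natAbs by omega)
    omega
  -- The loop state holds `b`, the next power of two and the list of the earlier ones. Doubling
  -- stops once the power exceeds `b`, after `b.toNat.size` rounds.
  have key : ∀ (b : ℤ) (k : ℕ),
      (fun s : ℤ × ℤ × List ℤ => (s.1, s.2.1 + s.2.1, s.2.1 :: s.2.2))^[k] (b, 1, []) =
        (b, 2 ^ k, ((List.range k).map fun k => 2 ^ k).reverse) := by
    intro b k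
    induction k with
    | zero => rfl
    | succ k ih =>
      rw [Function.iterate_succ_apply', ih, List.range_succ]
      simp [pow_succ, mul_two]
  have hpow : ∀ k : ℕ, esize (2 ^ k : ℤ) = k + 2 := by
    intro k
    rw [esize_int, Int.natAbs_pow]
    simp [Nat.size_pow]
  have := iterate (α := ℤ) (β := ℤ × ℤ × List ℤ) (c := fun s => decide (s.2.1 ≤ s.1))
    (f := fun s => (s.1, s.2.1 + s.2.1, s.2.1 :: s.2.2)) (i := fun b => (b, 1, []))
    ((fst (snd .id)).le (fst .id))
    ((fst .id).mk (((fst (snd .id)).add (fst (snd .id))).mk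
      ((fst (snd .id)).cons (snd (snd .id)))))
    (PolyTime.id.mk ((PolyTime.const 1).mk (.const []))) hsize
    (φ := fun b => esize b + (b.toNat.size + 2 + (b.toNat.size * (b.toNat.size + 3) + 1) + 1) + 1)
    ((PolyBounded.esize.add (((hsize.add (.const 2)).add ((hsize.mul (hsize.add (.const 3))).add
      (.const 1))).add (.const 1))).add (.const 1))
    (fun b k hk => by
      rw [key, esize_mk, esize_mk, hpow]
      have := esize_list_le (l := ((List.range k).map fun k => (2 : ℤ) ^ k).reverse)
        (n := b.toNat.size) (c := b.toNat.size + 2) (by simpa using hk) (by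
          intro a ha
          simp only [List.mem_reverse, List.mem_map, List.mem_range] at ha
          obtain ⟨l, hl, rfl⟩ := ha
          rw [hpow]
          omega)
      change _ ≤ b.toNat.size * (b.toNat.size + 3) + 1 at this
      omega)
    (fun b k hk => by
      rw [key]
      have := Nat.lt_size.1 hk
      have : (2 : ℤ) ^ k ≤ b.toNat := by exact_mod_cast this
      have h₁ : (0 : ℤ) < 2 ^ k := by positivity
      simp only [decide_eq_true_eq]
      omega)
    (fun b => by
      rw [key]
      have := Nat.lt_size_self b.toNat
      have : (b.toNat : ℤ) < (2 : ℤ) ^ b.toNat.size := by exact_mod_cast this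
      simp only [decide_eq_false_iff_not, not_le]
      omega)
  -- The power at which the loop stopped belongs to the list as well.
  have := (((fst (snd this)).cons (snd (snd this))).comp hb :)
  convert this using 2 with x
  rw [key, PMask.powersUpTo, List.range_succ]
  simp

theorem maxFlow {N : α → Network} (hN : PolyTime N) : PolyTime fun x => maxFlow (N x) := by
  unfold PMask.maxFlow
  have hp := hN.supply.powersUpTo
  have hn : PolyTime fun x => nodes (N x) := hN.fst.append hN.snd.fst
  have h₁ : PolyBounded fun x => (nodes (N x) ++ nodes (N x)).length :=
    (hn.append hn).esize.mono fun x => length_le_esize _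
  have h₂ : PolyTime fun p : α × ℤ => p.1 := fst .id
  have h₃ : PolyTime fun p : α × ℤ => (N p.1, p.2) := (hN.comp h₂).mk (snd .id)
  have hb : PolyBounded fun p : α × ℤ => (nodes (N p.1) ++ nodes (N p.1)).length *
      augmentationBound (N p.1) p.2 :=
    (h₂.bound_comp h₁).mul (h₃.bound_comp polyBounded_augmentationBound)
  -- The growth in a phase depends on `d`; since `d` runs through a list of polynomial size, one
  -- bound `ψ` serves all phases.
  obtain ⟨ψ, hψ, h⟩ := bound_bind hp hb
  have hg : PolyTime fun p : α × Pushes × ℤ => PMask.augmentPhase (N p.1) p.2.1 p.2.2 :=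
    augmentPhase (hN.comp (fst .id)) (fst (snd .id)) (snd (snd .id))
  have hs : ∀ x f, ∀ d ∈ PMask.powersUpTo (PMask.supply (N x)),
      esize (PMask.augmentPhase (N x) f d) ≤ esize f + ψ x := fun x f d hd =>
    (esize_foldl_augment_le _ _ _ _).trans (Nat.add_le_add_left (h x d hd) _)
  exact (foldl_of_additive (g := fun x f d => PMask.augmentPhase (N x) f d) hp (.const [])
    hg hψ hs :)

theorem feasible {N : α → Network} (hN : PolyTime N) : PolyTime fun x => feasible (N x) :=
  hN.supply.eq (.sum (PolyTime.map (g := fun _ r => r.2.2) hN.maxFlow (snd (snd (snd .id)))))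

end PolyTime
end PolyTimeFlow

/-! ## Correctness of the flow algorithm -/

theorem outflow_cons (e : ℤ × ℤ × ℤ) (f : Pushes) (i : ℤ) :
    outflow (e :: f) i = (if e.1 = i then e.2.2 else 0) + outflow f i := by
  simp only [outflow, List.filter_cons, decide_eq_true_eq]
  split <;> simp

theorem inflow_cons (e : ℤ × ℤ × ℤ) (f : Pushes) (j : ℤ) :
    inflow (e :: f) j = (if e.2.1 = j then e.2.2 else 0) + inflow f j := by
  simp only [inflow, List.filter_cons, decide_eq_true_eq]
  split <;> simp

theorem flow_cons (e : ℤ × ℤ × ℤ) (f : Pushes) (i j : ℤ) :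
    flow (e :: f) i j = (if e.1 = i ∧ e.2.1 = j then e.2.2 else 0) + flow f i j := by
  simp only [flow, List.filter_cons, Bool.and_eq_true, decide_eq_true_eq]
  split <;> simp

theorem total_cons (e : ℤ × ℤ × ℤ) (f : Pushes) : total (e :: f) = e.2.2 + total f := by
  simp [total]

theorem outflow_append (f g : Pushes) (i : ℤ) : outflow (f ++ g) i = outflow f i + outflow g i := by
  simp [outflow]

theorem inflow_append (f g : Pushes) (j : ℤ) : inflow (f ++ g) j = inflow f j + inflow g j := by
  simp [inflow]

theorem flow_append (f g : Pushes) (i j : ℤ) : flow (f ++ g) i j = flow f i j + flow g i j := by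
  simp [flow]

theorem total_append (f g : Pushes) : total (f ++ g) = total f + total g := by
  simp [total]

theorem exists_mem_of_flow_ne_zero {f : Pushes} {i j : ℤ} (h : flow f i j ≠ 0) :
    ∃ e ∈ f, e.1 = i ∧ e.2.1 = j := by
  by_contra! hf
  refine h ?_
  rw [flow, List.filter_eq_nil_iff.2]
  · rfl
  · intro e he
    simpa using hf e he

theorem sum_flow_right {f : Pushes} {J : Finset ℤ} (h : ∀ e ∈ f, e.2.1 ∈ J) (i : ℤ) :
    ∑ j ∈ J, flow f i j = outflow f i := by
  induction f with
  | nil => simp [flow, outflow]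
  | cons e f ih =>
    have h₁ := h e List.mem_cons_self
    simp only [flow_cons, outflow_cons, Finset.sum_add_distrib,
      ih fun e he => h e (List.mem_cons_of_mem _ he), ite_and]
    congr 1
    by_cases h₂ : e.1 = i <;> simp [h₁, h₂]

theorem sum_flow_left {f : Pushes} {I : Finset ℤ} (h : ∀ e ∈ f, e.1 ∈ I) (j : ℤ) :
    ∑ i ∈ I, flow f i j = inflow f j := by
  induction f with
  | nil => simp [flow, inflow]
  | cons e f ih =>
    have h₁ := h e List.mem_cons_self
    simp only [flow_cons, inflow_cons, Finset.sum_add_distrib,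
      ih fun e he => h e (List.mem_cons_of_mem _ he), ite_and]
    congr 1
    simp [h₁]

theorem sum_outflow {f : Pushes} {I : Finset ℤ} (h : ∀ e ∈ f, e.1 ∈ I) :
    ∑ i ∈ I, outflow f i = total f := by
  induction f with
  | nil => simp [total, outflow]
  | cons e f ih =>
    have h₁ := h e List.mem_cons_self
    simp [total_cons, outflow_cons, Finset.sum_add_distrib,
      ih fun e he => h e (List.mem_cons_of_mem _ he), h₁]

theorem sum_inflow {f : Pushes} {J : Finset ℤ} (h : ∀ e ∈ f, e.2.1 ∈ J) :
    ∑ j ∈ J, inflow f j = total f := by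
  induction f with
  | nil => simp [total, inflow]
  | cons e f ih =>
    have h₁ := h e List.mem_cons_self
    simp [total_cons, inflow_cons, Finset.sum_add_distrib,
      ih fun e he => h e (List.mem_cons_of_mem _ he), h₁]

/-! ### Association lists as functions on their keys -/

/-- The keys of an association list. -/
def keys (l : List (ℤ × ℤ)) : Finset ℤ := (l.map Prod.fst).toFinset

/-- The value at a key, `0` if it does not occur. -/
def lookup (l : List (ℤ × ℤ)) (k : ℤ) : ℤ := ((l.filter fun r => r.1 = k).map fun r => r.2).sum

theorem lookup_cons (r : ℤ × ℤ) (l : List (ℤ × ℤ)) (k : ℤ) :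
    lookup (r :: l) k = (if r.1 = k then r.2 else 0) + lookup l k := by
  simp only [lookup, List.filter_cons, decide_eq_true_eq]
  split <;> simp

theorem lookup_eq_zero {l : List (ℤ × ℤ)} {k : ℤ} (h : k ∉ l.map Prod.fst) : lookup l k = 0 := by
  rw [lookup, List.filter_eq_nil_iff.2]
  · rfl
  · intro r hr hk
    exact h (List.mem_map.2 ⟨r, hr, by simpa using hk⟩)

theorem lookup_eq {l : List (ℤ × ℤ)} (h : (l.map Prod.fst).Nodup) {r : ℤ × ℤ} (hr : r ∈ l) :
    lookup l r.1 = r.2 := by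
  induction l with
  | nil => simp at hr
  | cons q l ih =>
    rw [List.map_cons, List.nodup_cons] at h
    rw [lookup_cons]
    rcases List.mem_cons.1 hr with rfl | hr
    · rw [if_pos rfl, lookup_eq_zero h.1, add_zero]
    · rw [ih h.2 hr, if_neg, zero_add]
      intro hq
      exact h.1 (hq ▸ List.mem_map_of_mem hr)

theorem mem_keys {l : List (ℤ × ℤ)} {k : ℤ} : k ∈ keys l ↔ ∃ r ∈ l, r.1 = k := by
  simp [keys]

theorem card_keys_le (l : List (ℤ × ℤ)) : (keys l).card ≤ l.length :=
  (List.toFinset_card_le _).trans (List.length_map _).le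

theorem mem_of_mem_keys {l : List (ℤ × ℤ)} (h : (l.map Prod.fst).Nodup) {k : ℤ}
    (hk : k ∈ keys l) : (k, lookup l k) ∈ l := by
  obtain ⟨r, hr, rfl⟩ := mem_keys.1 hk
  rwa [lookup_eq h hr]

theorem sum_lookup {l : List (ℤ × ℤ)} {I : Finset ℤ} (h : ∀ r ∈ l, r.1 ∈ I) :
    ∑ k ∈ I, lookup l k = (l.map fun r => r.2).sum := by
  induction l with
  | nil => simp [lookup]
  | cons r l ih =>
    simp [lookup_cons, Finset.sum_add_distrib, ih fun e he => h e (List.mem_cons_of_mem _ he),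
      h r List.mem_cons_self]

/-! ### Flows and the search for augmenting paths -/

/-- Nonnegative supplies and demands with the same sum, no node being named twice. -/
structure Network.Valid (N : Network) : Prop where
  nodup_left : (N.1.map Prod.fst).Nodup
  nodup_right : (N.2.1.map Prod.fst).Nodup
  nonneg_left : ∀ r ∈ N.1, 0 ≤ r.2
  nonneg_right : ∀ c ∈ N.2.1, 0 ≤ c.2
  balanced : supply N = (N.2.1.map fun c => c.2).sum

/-- `f` is a flow through `N` in units of `d`. -/
structure IsFlow (N : Network) (d : ℤ) (f : Pushes) : Prop where
  allowed : ∀ e ∈ f, e.1 ∈ keys N.1 ∧ e.2.1 ∈ keys N.2.1 ∧ memPair N.2.2 e.1 e.2.1 = true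
  nonneg : ∀ i j, 0 ≤ flow f i j
  dvd : ∀ i j, d ∣ flow f i j
  outflow_le : ∀ r ∈ N.1, outflow f r.1 ≤ r.2
  inflow_le : ∀ c ∈ N.2.1, inflow f c.1 ≤ c.2

theorem IsFlow.of_dvd {N : Network} {d d' : ℤ} {f : Pushes} (h : IsFlow N d f) (hd : d' ∣ d) :
    IsFlow N d' f :=
  { h with dvd := fun i j => hd.trans (h.dvd i j) }

/-- A path of the search for augmentations: pushing along `p` moves `d` units from some source with
unused supply to `i`. -/
structure IsSearchPath (N : Network) (f : Pushes) (d : ℤ) (R : List (ℤ × Pushes)) (i : ℤ)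
    (p : Pushes) : Prop where
  mem : i ∈ keys N.1
  outflow_eq : ∃ s ∈ N.1, outflow f s.1 + d ≤ s.2 ∧
    ∀ k, outflow p k = (if k = s.1 then d else 0) - if k = i then d else 0
  inflow_eq : ∀ j, inflow p j = 0
  total_eq : total p = 0
  nonneg : ∀ k j, 0 ≤ flow f k j + flow p k j
  nonneg_of_notMem : ∀ k j, k ∉ R.map Prod.fst → 0 ≤ flow p k j
  dvd : ∀ k j, d ∣ flow p k j
  allowed : ∀ e ∈ p, e.1 ∈ keys N.1 ∧ e.2.1 ∈ keys N.2.1 ∧ memPair N.2.2 e.1 e.2.1 = true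

def IsSearch (N : Network) (f : Pushes) (d : ℤ) (R : List (ℤ × Pushes)) : Prop :=
  (R.map Prod.fst).Nodup ∧ ∀ e ∈ R, IsSearchPath N f d R e.1 e.2

theorem grow_cases (N : Network) (f : Pushes) (d : ℤ) (R : List (ℤ × Pushes)) :
    (grow N f d R = R ∧ ∀ e ∈ candidates N f d R, e.1 ∈ R.map Prod.fst) ∨
    ∃ e ∈ candidates N f d R, e.1 ∉ R.map Prod.fst ∧ grow N f d R = e :: R := by
  have hmem : ∀ k : ℤ, (R.any fun e' => decide (e'.1 = k)) = true ↔ k ∈ R.map Prod.fst := by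
    intro k
    simp [List.any_eq_true]
  rw [grow]
  rcases h : (candidates N f d R).filter fun e => !(R.any fun e' => e'.1 = e.1) with _ | ⟨e, l⟩
  · refine .inl ⟨by rw [h]; rfl, fun e he => ?_⟩
    have := List.filter_eq_nil_iff.1 h e he
    rw [← hmem]
    simpa using this
  · have := List.mem_filter.1 (h ▸ List.mem_cons_self :
      e ∈ (candidates N f d R).filter fun e => !(R.any fun e' => e'.1 = e.1))
    refine .inr ⟨e, this.1, fun h' => ?_, by rw [h]; rfl⟩
    have h₂ := this.2
    rw [(hmem _).2 h'] at h₂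
    simp at h₂

theorem mem_candidates {N : Network} {f : Pushes} {d : ℤ} {R : List (ℤ × Pushes)}
    {e : ℤ × Pushes} : e ∈ candidates N f d R ↔
      (∃ r ∈ N.1, outflow f r.1 + d ≤ r.2 ∧ e = (r.1, [])) ∨
      ∃ e' ∈ R, ∃ c ∈ N.2.1, memPair N.2.2 e'.1 c.1 = true ∧ ∃ r ∈ N.1, d ≤ flow f r.1 c.1 ∧
        e = (r.1, (e'.1, c.1, d) :: (r.1, c.1, -d) :: e'.2) := by
  simp only [candidates, List.mem_append, List.mem_map, List.mem_flatMap, List.mem_filter,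
    decide_eq_true_eq, and_assoc, @eq_comm _ _ e]

/-- If a path frees `d` units for `i`, let `i` send them to `c` and withdraw `d` units that `r`
sends to `c`. The inflow of `c` is unchanged, and the `d` free units are now at `r`. -/
theorem IsSearch.grow {N : Network} {f : Pushes} {d : ℤ} {R : List (ℤ × Pushes)} (hd : 0 < d)
    (hf : IsFlow N d f) (hR : IsSearch N f d R) : IsSearch N f d (grow N f d R) := by
  rcases grow_cases N f d R with ⟨h, -⟩ | ⟨e, he, heR, h⟩
  · rwa [h]
  rw [h]
  refine ⟨List.nodup_cons.2 ⟨heR, hR.1⟩, fun e' he' => ?_⟩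
  rcases List.mem_cons.1 he' with rfl | he'
  · rcases mem_candidates.1 he with ⟨r, hr, hs, rfl⟩ | ⟨⟨i, p⟩, hp, c, hc, hic, r, hr, hfl, rfl⟩
    · exact ⟨mem_keys.2 ⟨r, hr, rfl⟩, ⟨r, hr, hs, fun k => by simp [outflow]⟩,
        fun _ => by simp [inflow], by simp [total], fun k j => by simpa [flow] using hf.nonneg k j,
        fun _ _ _ => by simp [flow], fun _ _ => by simp [flow], by simp⟩
    · have P : IsSearchPath N f d R i p := hR.2 _ hp
      have hir : i ≠ r.1 := fun h => heR (List.mem_map.2 ⟨_, hp, h⟩)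
      have hflow : ∀ k j, flow ((i, c.1, d) :: (r.1, c.1, -d) :: p) k j =
          (if i = k ∧ c.1 = j then d else 0) + ((if r.1 = k ∧ c.1 = j then -d else 0) +
            flow p k j) := fun k j => by rw [flow_cons, flow_cons]
      refine ⟨mem_keys.2 ⟨r, hr, rfl⟩, ?_, fun j => ?_, ?_, fun k j => ?_, fun k j hk => ?_,
        fun k j => ?_, fun e he => ?_⟩
      · obtain ⟨s, hs, hs', ho⟩ := P.outflow_eq
        refine ⟨s, hs, hs', fun k => ?_⟩
        simp only [outflow_cons, ho, @eq_comm _ k i, @eq_comm _ k r.1]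
        split_ifs <;> omega
      · simp only [inflow_cons, P.inflow_eq]
        split_ifs <;> omega
      · simp [total_cons, P.total_eq]
      · rw [hflow]
        have h₁ := P.nonneg k j
        -- The source `r.1` is new, so `p` has taken nothing from its flow, which is at least `d`
        -- and survives the push by `-d`.
        have h₂ := P.nonneg_of_notMem r.1 c.1 heR
        by_cases h₃ : r.1 = k ∧ c.1 = j
        · obtain ⟨rfl, rfl⟩ := h₃
          rw [if_pos (show r.1 = r.1 ∧ c.1 = c.1 from ⟨rfl, rfl⟩)]
          split_ifs <;> omega
        · rw [if_neg h₃]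
          split_ifs <;> omega
      · rw [hflow]
        simp only [List.map_cons, List.mem_cons, not_or] at hk
        have h₁ := P.nonneg_of_notMem k j hk.2
        rw [if_neg (show ¬(r.1 = k ∧ c.1 = j) from fun h => hk.1 h.1.symm)]
        split_ifs <;> omega
      · rw [hflow]
        refine dvd_add ?_ (dvd_add ?_ (P.dvd k j)) <;> split_ifs <;> simp
      · rcases List.mem_cons.1 he with rfl | he
        · exact ⟨P.mem, mem_keys.2 ⟨c, hc, rfl⟩, hic⟩
        rcases List.mem_cons.1 he with rfl | he
        · obtain ⟨e, he, h₁, h₂⟩ := exists_mem_of_flow_ne_zero (f := f) (i := r.1) (j := c.1)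
            (by omega)
          simpa [← h₁, ← h₂] using hf.allowed e he
        · exact P.allowed e he
  · have P := hR.2 _ he'
    exact { P with
      nonneg_of_notMem := fun k j hk => P.nonneg_of_notMem k j fun h =>
        hk (List.mem_cons_of_mem _ h) }

theorem isSearch_iterate {N : Network} {f : Pushes} {d : ℤ} (hd : 0 < d) (hf : IsFlow N d f)
    (n : ℕ) : IsSearch N f d ((grow N f d)^[n] []) := by
  induction n with
  | zero => exact ⟨by simp, by simp⟩
  | succ n ih => rw [Function.iterate_succ_apply']; exact ih.grow hd hf

theorem reached_eq_iterate (N : Network) (f : Pushes) (d : ℤ) :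
    reached N f d = (grow N f d)^[N.1.length] [] := List.foldl_const _ _ _

/-- The search is finished: all candidates have been reached. -/
theorem mem_reached_of_mem_candidates {N : Network} {f : Pushes} {d : ℤ} (hd : 0 < d)
    (hf : IsFlow N d f) {e : ℤ × Pushes} (he : e ∈ candidates N f d (reached N f d)) :
    e.1 ∈ (reached N f d).map Prod.fst := by
  by_contra hcon
  -- Either the search is saturated after `n` rounds, or each of the first `n + 1` rounds has added
  -- a source. For `n = N.1.length` the latter would give more distinct sources than exist.
  have key : ∀ n, (∀ e ∈ candidates N f d ((grow N f d)^[n] []),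
      e.1 ∈ ((grow N f d)^[n] []).map Prod.fst) ∨ ((grow N f d)^[n + 1] []).length = n + 1 := by
    intro n
    induction n with
    | zero =>
      rcases grow_cases N f d [] with h | ⟨e, -, -, h⟩
      · exact .inl h.2
      · exact .inr (by simp [h])
    | succ n ih =>
      rcases ih with h | h
      · rcases grow_cases N f d ((grow N f d)^[n] []) with h' | ⟨e, he, h', -⟩
        · rw [Function.iterate_succ_apply', h'.1]
          exact .inl h
        · exact absurd (h e he) h'
      · rcases grow_cases N f d ((grow N f d)^[n + 1] []) with h' | ⟨e, -, -, h'⟩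
        · exact .inl h'.2
        · refine .inr ?_
          rw [Function.iterate_succ_apply', h', List.length_cons, h]
  rw [reached_eq_iterate] at he hcon
  rcases key N.1.length with h | h
  · exact hcon (h e he)
  · have hS := isSearch_iterate hd hf (N.1.length + 1)
    have h₁ : (((grow N f d)^[N.1.length + 1] []).map Prod.fst).toFinset ⊆ keys N.1 := by
      intro i hi
      obtain ⟨e, he, rfl⟩ := List.mem_map.1 (List.mem_toFinset.1 hi)
      exact (hS.2 e he).mem
    have h₂ := Finset.card_le_card h₁
    have h₃ := card_keys_le N.1
    rw [List.toFinset_card_of_nodup hS.1, List.length_map, h] at h₂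
    omega

theorem isSearch_reached {N : Network} {f : Pushes} {d : ℤ} (hd : 0 < d) (hf : IsFlow N d f) :
    IsSearch N f d (reached N f d) := by
  rw [reached_eq_iterate]
  exact isSearch_iterate hd hf _

/-! ### Cuts, near maximality and the scaling argument -/

open Classical in
/-- The capacity of the cut that is given by a set of sources. -/
noncomputable def cut (N : Network) (X : Finset ℤ) : ℤ :=
  ∑ i ∈ keys N.1 with i ∉ X, lookup N.1 i +
    ∑ j ∈ keys N.2.1 with ∃ i ∈ X, i ∈ keys N.1 ∧ memPair N.2.2 i j = true, lookup N.2.1 j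

/-- Some cut exceeds the flow by less than `d` for each node. -/
def NearlyMaximal (N : Network) (d : ℤ) (f : Pushes) : Prop :=
  ∃ X, cut N X ≤ total f + (d - 1) * (nodes N).length

theorem mem_augmentations {N : Network} {f : Pushes} {d : ℤ} {p : Pushes} :
    p ∈ augmentations N f d ↔ ∃ e ∈ reached N f d, ∃ c ∈ N.2.1,
      memPair N.2.2 e.1 c.1 = true ∧ inflow f c.1 + d ≤ c.2 ∧ p = (e.1, c.1, d) :: e.2 := by
  simp only [augmentations, List.mem_map, List.mem_flatMap, List.mem_filter,
    decide_eq_true_eq, and_assoc, Bool.and_eq_true, @eq_comm _ _ p]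

/-- Without an augmentation the flow is nearly maximal. -/
theorem nearlyMaximal_of_augmentations_eq_nil {N : Network} (hN : N.Valid) {f : Pushes} {d : ℤ}
    (hd : 0 < d) (hf : IsFlow N d f) (h : augmentations N f d = []) : NearlyMaximal N d f := by
  classical
  -- The cut is given by the reached sources `X`; the sinks `Y` adjacent to `X` are those on its
  -- side. An unreached source with `d` units of unused supply would be a candidate, and a sink in
  -- `Y` with room for `d` units would yield an augmentation.
  set R := reached N f d with hR
  set X := (R.map Prod.fst).toFinset with hX
  have hXmem : ∀ i, i ∈ X ↔ ∃ e ∈ R, e.1 = i := by simp [hX]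
  refine ⟨X, ?_⟩
  have hX₁ : ∀ i ∈ X, i ∈ keys N.1 := by
    intro i hi
    obtain ⟨e, he, rfl⟩ := (hXmem i).1 hi
    exact ((isSearch_reached hd hf).2 e he).mem
  have h₁ : ∀ i ∈ keys N.1, i ∉ X → lookup N.1 i ≤ outflow f i + (d - 1) := by
    intro i hi hiX
    by_contra! hlt
    refine hiX ?_
    have := mem_reached_of_mem_candidates hd hf (e := (i, [])) (mem_candidates.2 (.inl
      ⟨_, mem_of_mem_keys hN.nodup_left hi, by simp only; omega, rfl⟩))
    exact List.mem_toFinset.2 this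
  set Y := (keys N.2.1).filter fun j => ∃ i ∈ X, i ∈ keys N.1 ∧ memPair N.2.2 i j = true with hY
  have hYmem : ∀ j, j ∈ Y ↔ j ∈ keys N.2.1 ∧ ∃ i ∈ X, i ∈ keys N.1 ∧
      memPair N.2.2 i j = true := by simp [hY]
  have h₂ : ∀ j ∈ Y, lookup N.2.1 j ≤ inflow f j + (d - 1) := by
    intro j hj
    obtain ⟨hj, i, hi, -, hij⟩ := (hYmem j).1 hj
    obtain ⟨e, he, rfl⟩ := (hXmem i).1 hi
    by_contra! hlt
    have := mem_augmentations.2 ⟨e, he, _, mem_of_mem_keys hN.nodup_right hj, hij,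
      by simp only; omega, rfl⟩
    rw [h] at this
    simp at this
  have h₃ : ∀ j ∈ Y, ∀ i ∈ keys N.1, i ∉ X → flow f i j = 0 := by
    intro j hj i hi hiX
    obtain ⟨hj, i', hi', -, hij⟩ := (hYmem j).1 hj
    obtain ⟨e, he, rfl⟩ := (hXmem i').1 hi'
    by_contra hne
    refine hiX ?_
    -- Flows are multiples of `d`, so a positive flow into `Y` is at least `d` and would make `i` a
    -- candidate.
    have hle : d ≤ flow f i j :=
      Int.le_of_dvd (lt_of_le_of_ne (hf.nonneg i j) (Ne.symm hne)) (hf.dvd i j)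
    have := mem_reached_of_mem_candidates hd hf (e := (i, _)) (mem_candidates.2 (.inr
      ⟨e, he, _, mem_of_mem_keys hN.nodup_right hj, hij, _, mem_of_mem_keys hN.nodup_left hi,
        hle, rfl⟩))
    exact List.mem_toFinset.2 this
  have h₄ : ∀ i ∈ X, ∀ j ∈ keys N.2.1, j ∉ Y → flow f i j = 0 := by
    intro i hi j hj hjY
    by_contra hne
    obtain ⟨e, he, rfl, rfl⟩ := exists_mem_of_flow_ne_zero hne
    exact hjY ((hYmem _).2 ⟨hj, _, hi, hX₁ _ hi, (hf.allowed e he).2.2⟩)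
  have hkX : (keys N.1).filter (· ∈ X) = X := by
    ext i
    simpa using hX₁ i
  -- All flow from `X` ends in `Y`, and all flow into `Y` comes from `X`. So the cut exceeds the
  -- total only by slack below `d` at single nodes.
  have h₅ : ∑ i ∈ X, outflow f i = ∑ j ∈ Y, inflow f j := by
    have e₁ : ∀ i ∈ X, outflow f i = ∑ j ∈ Y, flow f i j := by
      intro i hi
      rw [← sum_flow_right fun e he => (hf.allowed e he).2.1]
      exact (Finset.sum_subset (Finset.filter_subset _ _) fun j hj hjY => h₄ i hi j hj hjY).symm
    have e₂ : ∀ j ∈ Y, inflow f j = ∑ i ∈ X, flow f i j := by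
      intro j hj
      rw [← sum_flow_left fun e he => (hf.allowed e he).1]
      exact (Finset.sum_subset hX₁ fun i hi hiX => h₃ j hj i hi hiX).symm
    rw [Finset.sum_congr rfl e₁, Finset.sum_congr rfl e₂, Finset.sum_comm]
  have h₆ : total f = ∑ i ∈ X, outflow f i + ∑ i ∈ keys N.1 with i ∉ X, outflow f i := by
    rw [← sum_outflow fun e he => (hf.allowed e he).1,
      ← Finset.sum_filter_add_sum_filter_not (keys N.1) (· ∈ X), hkX]
  have h₇ : ∑ i ∈ keys N.1 with i ∉ X, lookup N.1 i ≤
      ∑ i ∈ keys N.1 with i ∉ X, outflow f i + (d - 1) * N.1.length := by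
    refine (Finset.sum_le_sum fun i hi => h₁ i (Finset.mem_filter.1 hi).1
      (Finset.mem_filter.1 hi).2).trans ?_
    rw [Finset.sum_add_distrib, Finset.sum_const, nsmul_eq_mul, mul_comm]
    gcongr
    · omega
    · exact_mod_cast (Finset.card_filter_le _ _).trans (card_keys_le _)
  have h₈ : ∑ j ∈ Y, lookup N.2.1 j ≤ ∑ j ∈ Y, inflow f j + (d - 1) * N.2.1.length := by
    refine (Finset.sum_le_sum h₂).trans ?_
    rw [Finset.sum_add_distrib, Finset.sum_const, nsmul_eq_mul, mul_comm]
    gcongr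
    · omega
    · exact_mod_cast (Finset.card_filter_le _ _).trans (card_keys_le _)
  rw [cut, nodes, List.length_append, h₆, h₅]
  push_cast
  linarith

/-- The final push spends at `c` the `d` units that the search path has freed at `i`. On balance
only the outflow of the source with unused supply and the inflow of `c` rise, each by `d`. -/
theorem augment_cases {N : Network} (hN : N.Valid) {f : Pushes} {d : ℤ} (hd : 0 < d)
    (hf : IsFlow N d f) :
    (augment N f d = f ∧ NearlyMaximal N d f) ∨
      IsFlow N d (augment N f d) ∧ total (augment N f d) = total f + d := by
  rcases h : augmentations N f d with _ | ⟨p, l⟩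
  · exact .inl ⟨by simp [augment, h], nearlyMaximal_of_augmentations_eq_nil hN hd hf h⟩
  right
  have hp : p ∈ augmentations N f d := h ▸ List.mem_cons_self
  have ha : augment N f d = p ++ f := by simp [augment, h]
  rw [ha]
  obtain ⟨⟨i, q⟩, he, c, hc, hic, hle, rfl⟩ := mem_augmentations.1 hp
  have P := (isSearch_reached hd hf).2 _ he
  refine ⟨⟨fun e he => ?_, fun k j => ?_, fun k j => ?_, fun r hr => ?_, fun c' hc' => ?_⟩, ?_⟩
  · rw [List.cons_append] at he
    rcases List.mem_cons.1 he with rfl | he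
    · exact ⟨P.mem, mem_keys.2 ⟨c, hc, rfl⟩, hic⟩
    rcases List.mem_append.1 he with he | he
    · exact P.allowed e he
    · exact hf.allowed e he
  · rw [flow_append, flow_cons]
    have := P.nonneg k j
    simp only at this ⊢
    split_ifs <;> omega
  · rw [flow_append, flow_cons]
    refine dvd_add (dvd_add ?_ (P.dvd k j)) (hf.dvd k j)
    split_ifs <;> simp
  · obtain ⟨s, hs, hs', ho⟩ := P.outflow_eq
    have h₁ := hf.outflow_le r hr
    rw [outflow_append, outflow_cons, ho]
    simp only [@eq_comm _ r.1 i]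
    by_cases h₂ : r.1 = s.1
    · have : r = s := Prod.ext h₂
        (by rw [← lookup_eq hN.nodup_left hr, ← lookup_eq hN.nodup_left hs, h₂])
      subst this
      split_ifs <;> omega
    · rw [if_neg h₂]
      split_ifs <;> omega
  · have h₁ := hf.inflow_le c' hc'
    rw [inflow_append, inflow_cons, P.inflow_eq]
    simp only
    by_cases h₂ : c.1 = c'.1
    · have : c = c' := Prod.ext h₂
        (by rw [← lookup_eq hN.nodup_right hc, ← lookup_eq hN.nodup_right hc', h₂])
      subst this
      rw [if_pos rfl]
      omega
    · rw [if_neg h₂]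
      omega
  · rw [total_append, total_cons, P.total_eq]
    simp only
    ring

/-- A phase of augmentations by `d` makes a nearly maximal flow in units of `2 * d` nearly maximal
in units of `d`. -/
theorem augmentPhase_spec {N : Network} (hN : N.Valid) {f : Pushes} {d : ℤ} (hd : 0 < d)
    (hf : IsFlow N d f) (hm : NearlyMaximal N (2 * d) f) :
    IsFlow N d (augmentPhase N f d) ∧ NearlyMaximal N d (augmentPhase N f d) := by
  -- Each round gains `d` unless the flow is nearly maximal already, and near maximality persists
  -- because totals never decrease.
  have key : ∀ n : ℕ, IsFlow N d ((fun f => augment N f d)^[n] f) ∧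
      (NearlyMaximal N d ((fun f => augment N f d)^[n] f) ∨
        total ((fun f => augment N f d)^[n] f) = total f + n * d) := by
    intro n
    induction n with
    | zero => exact ⟨hf, .inr (by simp)⟩
    | succ n ih =>
      simp only [Function.iterate_succ_apply']
      rcases augment_cases hN hd ih.1 with ⟨h, h'⟩ | ⟨h, h'⟩
      · simp only [h]
        exact ⟨ih.1, .inl h'⟩
      · refine ⟨h, ?_⟩
        rcases ih.2 with ⟨X, hX⟩ | ht
        · exact .inl ⟨X, by rw [h']; omega⟩
        · refine .inr ?_
          rw [h', ht]
          push_cast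
          ring
  rw [augmentPhase, List.foldl_const, List.length_append]
  obtain ⟨h₁, h₂ | h₂⟩ := key ((nodes N).length + (nodes N).length)
  · exact ⟨h₁, h₂⟩
  -- If every round succeeded, the gain is `2 * d` for each node, more than the gap of `2 * d - 1`
  -- for each node left by the previous phase.
  · obtain ⟨X, hX⟩ := hm
    refine ⟨h₁, X, hX.trans ?_⟩
    rw [h₂]
    push_cast
    have : (0 : ℤ) ≤ (nodes N).length := by positivity
    nlinarith

theorem isFlow_nil {N : Network} (hN : N.Valid) (d : ℤ) : IsFlow N d [] :=
  ⟨by simp, by simp [flow], by simp [flow],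
    fun r hr => by simpa [outflow] using hN.nonneg_left r hr,
    fun r hr => by simpa [inflow] using hN.nonneg_right r hr⟩

theorem cut_empty (N : Network) : cut N ∅ = supply N := by
  classical
  simp [cut, supply, sum_lookup (l := N.1) (I := keys N.1) fun r hr => mem_keys.2 ⟨r, hr, rfl⟩]

theorem supply_nonneg {N : Network} (hN : N.Valid) : 0 ≤ supply N :=
  List.sum_nonneg fun a ha => by
    obtain ⟨r, hr, rfl⟩ := List.mem_map.1 ha
    exact hN.nonneg_left r hr

/-- A flow in units of `2 * d` is one in units of `d`, so the phases chain. At the end `d - 1 = 0`: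
the flow reaches the capacity of a cut. -/
theorem maxFlow_spec {N : Network} (hN : N.Valid) :
    IsFlow N 1 (maxFlow N) ∧ NearlyMaximal N 1 (maxFlow N) := by
  have key : ∀ (n : ℕ) (f : Pushes), IsFlow N (2 ^ n) f → NearlyMaximal N (2 * 2 ^ n) f →
      IsFlow N 1 (((List.range (n + 1)).map fun k => (2 : ℤ) ^ k).reverse.foldl
        (fun f d => augmentPhase N f d) f) ∧
      NearlyMaximal N 1 (((List.range (n + 1)).map fun k => (2 : ℤ) ^ k).reverse.foldl
        (fun f d => augmentPhase N f d) f) := by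
    intro n
    induction n with
    | zero =>
      intro f hf hm
      simpa using augmentPhase_spec hN one_pos (by simpa using hf) (by simpa using hm)
    | succ n ih =>
      intro f hf hm
      obtain ⟨h₁, h₂⟩ := augmentPhase_spec hN (by positivity) hf hm
      rw [List.range_succ, List.map_append, List.reverse_append]
      refine ih _ (h₁.of_dvd ⟨2, pow_succ _ _⟩) ?_
      rw [← pow_succ']
      exact h₂
  -- The empty flow is nearly maximal for the starting unit: the cut of `∅` is the whole supply,
  -- which lies below the first power of two. This needs a node; without sources the supply is zero.
  refine key _ _ (isFlow_nil hN _) ⟨∅, ?_⟩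
  rw [cut_empty]
  have h₁ := supply_nonneg hN
  have h₂ := Nat.lt_size_self (supply N).toNat
  have h₃ : ((supply N).toNat : ℤ) < (2 : ℤ) ^ (supply N).toNat.size := by exact_mod_cast h₂
  rw [Int.toNat_of_nonneg h₁] at h₃
  simp only [total, List.map_nil, List.sum_nil, zero_add]
  rcases h : N.1 with _ | ⟨r, l⟩
  · have : supply N = 0 := by simp [supply, h]
    rw [this]
    simp
  · have h₄ : (1 : ℤ) ≤ (nodes N).length := by simp [nodes, h]; positivity
    nlinarith

open Classical in
/-- The algorithm decides whether the transportation problem has a solution. -/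
theorem feasible_iff {N : Network} (hN : N.Valid) :
    feasible N = true ↔ ∃ x : ℤ → ℤ → ℝ, (∀ i ∈ keys N.1, ∀ j ∈ keys N.2.1, 0 ≤ x i j) ∧
      (∀ r ∈ N.1, ∑ j ∈ keys N.2.1, x r.1 j = r.2) ∧
      (∀ c ∈ N.2.1, ∑ i ∈ keys N.1, x i c.1 = c.2) ∧
      ∀ i ∈ keys N.1, ∀ j ∈ keys N.2.1, x i j ≠ 0 → memPair N.2.2 i j = true := by
  obtain ⟨hf, X, hX⟩ := maxFlow_spec hN
  have hsup : ∑ i ∈ keys N.1, lookup N.1 i = supply N :=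
    sum_lookup fun r hr => mem_keys.2 ⟨r, hr, rfl⟩
  have hdem : ∑ j ∈ keys N.2.1, lookup N.2.1 j = supply N := by
    rw [hN.balanced]
    exact sum_lookup fun r hr => mem_keys.2 ⟨r, hr, rfl⟩
  have hout := sum_outflow fun e he => (hf.allowed e he).1
  have hin := sum_inflow fun e he => (hf.allowed e he).2.1
  have ho : ∀ i ∈ keys N.1, outflow (maxFlow N) i ≤ lookup N.1 i := fun i hi =>
    hf.outflow_le _ (mem_of_mem_keys hN.nodup_left hi)
  have hi : ∀ j ∈ keys N.2.1, inflow (maxFlow N) j ≤ lookup N.2.1 j := fun j hj =>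
    hf.inflow_le _ (mem_of_mem_keys hN.nodup_right hj)
  rw [feasible, decide_eq_true_eq]
  constructor
  · intro h
    -- When the total equals the supply, and so by balance the demand, all capacity bounds are
    -- equalities.
    have e₁ := (Finset.sum_eq_sum_iff_of_le ho).1 (by rw [hout, hsup, h])
    have e₂ := (Finset.sum_eq_sum_iff_of_le hi).1 (by rw [hin, hdem, h])
    refine ⟨fun i j => flow (maxFlow N) i j, fun i _ j _ => by simpa using hf.nonneg i j,
      fun r hr => ?_, fun c hc => ?_, fun i _ j _ hne => ?_⟩
    · rw [← Int.cast_sum, sum_flow_right fun e he => (hf.allowed e he).2.1,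
        e₁ _ (mem_keys.2 ⟨r, hr, rfl⟩), lookup_eq hN.nodup_left hr]
    · rw [← Int.cast_sum, sum_flow_left fun e he => (hf.allowed e he).1,
        e₂ _ (mem_keys.2 ⟨c, hc, rfl⟩), lookup_eq hN.nodup_right hc]
    · obtain ⟨e, he, rfl, rfl⟩ := exists_mem_of_flow_ne_zero (Int.cast_ne_zero.1 hne)
      exact (hf.allowed e he).2.2
  · rintro ⟨x, hx₀, hx₁, hx₂, hx₃⟩
    have hx₁' : ∀ i ∈ keys N.1, ∑ j ∈ keys N.2.1, x i j = lookup N.1 i := fun i hi =>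
      hx₁ _ (mem_of_mem_keys hN.nodup_left hi)
    have hx₂' : ∀ j ∈ keys N.2.1, ∑ i ∈ keys N.1, x i j = lookup N.2.1 j := fun j hj =>
      hx₂ _ (mem_of_mem_keys hN.nodup_right hj)
    refine le_antisymm ?_ ?_
    · refine le_trans ?_ (hX.trans (by simp))
      rw [← hsup, ← Finset.sum_filter_add_sum_filter_not (keys N.1) (· ∈ X), cut, add_comm]
      gcongr 1
      -- Weak duality: a real solution carries the whole supply of `X` to sinks adjacent to `X`. So
      -- the cut, and with it the computed flow, is at least the supply.
      have : (∑ i ∈ keys N.1 with i ∈ X, (lookup N.1 i : ℝ)) ≤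
          ∑ j ∈ keys N.2.1 with ∃ i ∈ X, i ∈ keys N.1 ∧ memPair N.2.2 i j = true,
            (lookup N.2.1 j : ℝ) := by
        calc ∑ i ∈ keys N.1 with i ∈ X, (lookup N.1 i : ℝ)
            = ∑ i ∈ keys N.1 with i ∈ X, ∑ j ∈ keys N.2.1 with
                ∃ i ∈ X, i ∈ keys N.1 ∧ memPair N.2.2 i j = true, x i j := by
              refine Finset.sum_congr rfl fun i hi => ?_
              obtain ⟨hi, hiX⟩ := Finset.mem_filter.1 hi
              rw [← hx₁' i hi]
              refine (Finset.sum_subset (Finset.filter_subset _ _) fun j hj hjY => ?_).symm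
              by_contra hne
              exact hjY (Finset.mem_filter.2 ⟨hj, i, hiX, hi, hx₃ i hi j hj hne⟩)
          _ = ∑ j ∈ keys N.2.1 with ∃ i ∈ X, i ∈ keys N.1 ∧ memPair N.2.2 i j = true,
                ∑ i ∈ keys N.1 with i ∈ X, x i j := Finset.sum_comm
          _ ≤ _ := by
              refine Finset.sum_le_sum fun j hj => ?_
              have hj := (Finset.mem_filter.1 hj).1
              rw [← hx₂' j hj]
              exact Finset.sum_le_sum_of_subset_of_nonneg (Finset.filter_subset _ _)
                fun i hi _ => hx₀ i hi j hj
      exact_mod_cast this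
    · rw [← hout, ← hsup]
      exact Finset.sum_le_sum ho


/-! ## Computing the winning region -/

/-- The points of a support with numerators and denominators. -/
abbrev DistList := List (ℤ × ℤ × ℤ)

abbrev NominalList := List (ℤ × ℤ × DistList)

abbrev ImplList := List (ℤ × (ℤ × ℤ) × DistList)

def denominators (μ : DistList) : ℤ := (μ.map fun e => e.2.2).prod

/-- The product of the denominators except that of `k`. -/
def cofactor (μ : DistList) (k : ℤ) : ℤ :=
  ((μ.filter fun e => !(e.1 = k)).map fun e => e.2.2).prod

/-- The probabilities, multiplied by all denominators and by `D`. -/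
def scaled (μ : DistList) (D : ℤ) : List (ℤ × ℤ) :=
  μ.map fun e => (e.1, e.2.1 * cofactor μ e.1 * D)

/-- The transportation problem of two distributions. -/
def network (μ μ' : DistList) (W : List (ℤ × ℤ)) : Network :=
  (scaled μ (denominators μ'), scaled μ' (denominators μ), W)

def simulatesNominal (T : NominalList) (T' : ImplList) (W : List (ℤ × ℤ)) (s s' : ℤ) : Bool :=
  T.all fun τ => !(τ.1 = s) || T'.any fun τ' => τ'.1 = s' && (τ'.2.1.1 = 0 &&
    (τ'.2.1.2 = τ.2.1 && feasible (network τ.2.2 τ'.2.2 W)))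

/-- The first component of a label is `0` for actions and `1` for faults. `[(s, 1, 1)]` is the Dirac
distribution at `s`. -/
def simulatesImpl (T : NominalList) (T' : ImplList) (W : List (ℤ × ℤ)) (s s' : ℤ) : Bool :=
  T'.all fun τ' => !(τ'.1 = s') ||
    ((τ'.2.1.1 = 0 && T.any fun τ => τ.1 = s && (τ.2.1 = τ'.2.1.2 &&
      feasible (network τ.2.2 τ'.2.2 W))) ||
    (!(τ'.2.1.1 = 0) && feasible (network [(s, 1, 1)] τ'.2.2 W)))

/-- The pairs in `W` at which every move has an answer that leads to `W`. -/
def refineRel (T : NominalList) (T' : ImplList) (W : List (ℤ × ℤ)) : List (ℤ × ℤ) :=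
  W.filter fun p => simulatesNominal T T' W p.1 p.2 && simulatesImpl T T' W p.1 p.2

/-- A transition leaves every state, so all states can be read off the transition lists, possibly
with repetitions. -/
def statePairs (T : NominalList) (T' : ImplList) : List (ℤ × ℤ) :=
  (T.map fun τ => τ.1) ×ˢ (T'.map fun τ => τ.1)

/-- The pairs at which the Verifier wins. -/
def winning (T : NominalList) (T' : ImplList) : List (ℤ × ℤ) :=
  (statePairs T T').foldl (fun W _ => refineRel T T' W) (statePairs T T')

/-- The pairs at which the Refuter wins. -/
def losing (T : NominalList) (T' : ImplList) : List (ℤ × ℤ) :=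
  (statePairs T T').filter fun p => !memPair (winning T T') p.1 p.2

/-! ### Polynomial time of the refinement -/

section PolyTimeGame

variable {α : Type} [Enc α]

namespace PolyTime

theorem scaled {μ : α → DistList} {D : α → ℤ} (hμ : PolyTime μ) (hD : PolyTime D) :
    PolyTime fun x => scaled (μ x) (D x) := by
  have h : PolyTime fun p : DistList × ℤ => PMask.scaled p.1 p.2 := by
    unfold PMask.scaled cofactor
    repeat' with_reducible first
        | apply PolyTime.id | apply PolyTime.fst | apply PolyTime.snd | apply PolyTime.map
        | apply PolyTime.filter | apply PolyTime.mul | apply PolyTime.prod | apply PolyTime.mk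
        | apply PolyTime.eq | apply PolyTime.not
  exact (h.comp (hμ.mk hD) :)

theorem denominators {μ : α → DistList} (hμ : PolyTime μ) :
    PolyTime fun x => denominators (μ x) :=
  .prod (PolyTime.map (g := fun _ e => e.2.2) hμ (snd (snd (snd .id))))

theorem network {μ μ' : α → DistList} {W : α → List (ℤ × ℤ)} (hμ : PolyTime μ)
    (hμ' : PolyTime μ') (hW : PolyTime W) : PolyTime fun x => network (μ x) (μ' x) (W x) :=
  (hμ.scaled hμ'.denominators).mk ((hμ'.scaled hμ.denominators).mk hW)

theorem simulatesNominal : PolyTime fun p : NominalList × ImplList × List (ℤ × ℤ) × ℤ × ℤ =>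
    simulatesNominal p.1 p.2.1 p.2.2.1 p.2.2.2.1 p.2.2.2.2 := by
  unfold PMask.simulatesNominal
  repeat' with_reducible first
      | apply PolyTime.id | apply PolyTime.fst | apply PolyTime.snd | apply PolyTime.const
      | apply PolyTime.all | apply PolyTime.any | apply PolyTime.eq | apply PolyTime.not
      | apply PolyTime.and | apply PolyTime.or | apply PolyTime.feasible | apply PolyTime.network

theorem simulatesImpl : PolyTime fun p : NominalList × ImplList × List (ℤ × ℤ) × ℤ × ℤ =>
    simulatesImpl p.1 p.2.1 p.2.2.1 p.2.2.2.1 p.2.2.2.2 := by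
  unfold PMask.simulatesImpl
  repeat' with_reducible first
      | apply PolyTime.id | apply PolyTime.fst | apply PolyTime.snd | apply PolyTime.const
      | apply PolyTime.all | apply PolyTime.any | apply PolyTime.eq | apply PolyTime.not
      | apply PolyTime.and | apply PolyTime.or | apply PolyTime.feasible | apply PolyTime.network
      | apply PolyTime.cons | apply PolyTime.mk

theorem refineRel : PolyTime fun p : NominalList × ImplList × List (ℤ × ℤ) =>
    refineRel p.1 p.2.1 p.2.2 := by
  have h : PolyTime fun q : (NominalList × ImplList × List (ℤ × ℤ)) × ℤ × ℤ =>
      (q.1.1, q.1.2.1, q.1.2.2, q.2.1, q.2.2) := by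
    repeat' with_reducible first
        | apply PolyTime.id | apply PolyTime.fst | apply PolyTime.snd | apply PolyTime.mk
  have h' := (simulatesNominal.comp h).and (simulatesImpl.comp h)
  exact PolyTime.filter (g := fun (p : NominalList × ImplList × List (ℤ × ℤ)) (q : ℤ × ℤ) =>
    PMask.simulatesNominal p.1 p.2.1 p.2.2 q.1 q.2 && PMask.simulatesImpl p.1 p.2.1 p.2.2 q.1 q.2)
    (snd (snd .id)) h'

theorem statePairs : PolyTime fun p : NominalList × ImplList => statePairs p.1 p.2 := by
  have h : PolyTime fun p : NominalList × ImplList => p.1.map fun τ => τ.1 :=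
    PolyTime.map (fst .id) (fst (snd .id))
  have h' : PolyTime fun p : NominalList × ImplList => p.2.map fun τ => τ.1 :=
    PolyTime.map (snd .id) (fst (snd .id))
  exact h.product h'

end PolyTime

/-- Rounds only delete pairs; this is the size bound for the loop that computes `winning`. -/
theorem foldl_refineRel_sublist (T : NominalList) (T' : ImplList) {β : Type} (l : List β)
    (W : List (ℤ × ℤ)) : (l.foldl (fun W _ => refineRel T T' W) W).Sublist W := by
  induction l generalizing W with
  | nil => exact List.Sublist.refl _
  | cons a l ih => exact (ih _).trans List.filter_sublist

namespace PolyTime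

theorem winning : PolyTime fun p : NominalList × ImplList => winning p.1 p.2 := by
  have h : PolyTime fun q : (NominalList × ImplList) × List (ℤ × ℤ) × ℤ × ℤ =>
      PMask.refineRel q.1.1 q.1.2 q.2.1 :=
    refineRel.comp ((fst (fst .id)).mk ((snd (fst .id)).mk (fst (snd .id))))
  exact PolyTime.foldl (g := fun (p : NominalList × ImplList) W _ => PMask.refineRel p.1 p.2 W)
    statePairs statePairs h statePairs.esize
    fun x p q _ => esize_le_of_sublist (foldl_refineRel_sublist _ _ _ _)

theorem losing : PolyTime fun p : NominalList × ImplList => losing p.1 p.2 :=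
  PolyTime.filter (g := fun (p : NominalList × ImplList) (q : ℤ × ℤ) =>
    !PMask.memPair (PMask.winning p.1 p.2) q.1 q.2) statePairs
    ((winning.comp (fst .id)).memPair (fst (snd .id)) (snd (snd .id))).not

end PolyTime
end PolyTimeGame

/-- A round that changes the list shortens it, so as many rounds as there are entries lead to a
fixed point. -/
theorem refineRel_winning (T : NominalList) (T' : ImplList) :
    refineRel T T' (winning T T') = winning T T' := by
  have key : ∀ (n : ℕ) (W : List (ℤ × ℤ)), W.length ≤ n →
      refineRel T T' ((refineRel T T')^[n] W) = (refineRel T T')^[n] W := by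
    intro n
    induction n with
    | zero =>
      intro W hW
      rw [List.length_eq_zero_iff.1 (by omega : W.length = 0)]
      rfl
    | succ n ih =>
      intro W hW
      have hs : (refineRel T T' W).Sublist W := List.filter_sublist
      rcases eq_or_ne (refineRel T T' W) W with h | h
      · rw [Function.iterate_fixed h, h]
      · rw [Function.iterate_succ_apply]
        refine ih _ ?_
        have := lt_of_le_of_ne hs.length_le fun h' => h (hs.eq_of_length h')
        omega
  have : winning T T' = (refineRel T T')^[(statePairs T T').length] (statePairs T T') :=
    List.foldl_const _ _ _
  rw [this]
  exact key _ _ le_rfl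

theorem memPair_iff {W : List (ℤ × ℤ)} {i j : ℤ} : memPair W i j = true ↔ (i, j) ∈ W := by
  simp only [memPair, List.any_eq_true, Bool.and_eq_true, decide_eq_true_eq]
  constructor
  · rintro ⟨⟨a, b⟩, h, rfl, rfl⟩
    exact h
  · exact fun h => ⟨_, h, rfl, rfl⟩


/-! ## Couplings and transportation problems -/

section Transport

variable {S S' : Type}

/-- `μ` can be transported to `μ'` along the pairs in `M`. -/
def Transport [Fintype S] [Fintype S'] (M : S → S' → Prop) (μ : PMF S) (μ' : PMF S') : Prop :=
  ∃ x : S → S' → ℝ, (∀ i j, 0 ≤ x i j) ∧ (∀ i, ∑ j, x i j = (μ i).toReal) ∧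
    (∀ j, ∑ i, x i j = (μ' j).toReal) ∧ ∀ i j, x i j ≠ 0 → M i j

variable [Fintype S] [Fintype S']

theorem sum_toReal (μ : PMF S) : ∑ i, (μ i).toReal = 1 := by
  rw [← ENNReal.toReal_sum fun i _ => μ.apply_ne_top i, ← tsum_fintype (L := .unconditional S),
    μ.tsum_coe, ENNReal.toReal_one]

theorem map_fst_apply (w : PMF (S × S')) (i : S) : w.map Prod.fst i = ∑ j, w (i, j) := by
  classical
  rw [PMF.map_apply, tsum_fintype, Fintype.sum_prod_type_right]
  simp

theorem map_snd_apply (w : PMF (S × S')) (j : S') : w.map Prod.snd j = ∑ i, w (i, j) := by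
  classical
  rw [PMF.map_apply, tsum_fintype, Fintype.sum_prod_type]
  simp

/-- On finite types a coupling is a nonnegative real matrix with the given row and column sums; its
total mass is `1` automatically. -/
theorem liftRel_iff_transport (M : S → S' → Prop) (μ : PMF S) (μ' : PMF S') :
    LiftRel M μ μ' ↔ Transport M μ μ' := by
  constructor
  · rintro ⟨w, ⟨rfl, rfl⟩, hM⟩
    refine ⟨fun i j => (w (i, j)).toReal, fun _ _ => ENNReal.toReal_nonneg, fun i => ?_,
      fun j => ?_, fun i j h => hM (i, j) ?_⟩
    · rw [map_fst_apply, ENNReal.toReal_sum fun _ _ => w.apply_ne_top _]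
    · rw [map_snd_apply, ENNReal.toReal_sum fun _ _ => w.apply_ne_top _]
    · rw [PMF.mem_support_iff]
      rintro h'
      simp [h'] at h
  · rintro ⟨x, hx, hμ, hμ', hM⟩
    refine ⟨PMF.ofFintype (fun p => ENNReal.ofReal (x p.1 p.2)) ?_, ⟨?_, ?_⟩, fun p hp => ?_⟩
    · rw [← ENNReal.ofReal_sum_of_nonneg fun p _ => hx _ _, Fintype.sum_prod_type]
      simp only [hμ, sum_toReal, ENNReal.ofReal_one]
    · ext i
      rw [map_fst_apply]
      simp only [PMF.ofFintype_apply]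
      rw [← ENNReal.ofReal_sum_of_nonneg fun j _ => hx i j, hμ,
        ENNReal.ofReal_toReal (μ.apply_ne_top i)]
    · ext j
      rw [map_snd_apply]
      simp only [PMF.ofFintype_apply]
      rw [← ENNReal.ofReal_sum_of_nonneg fun i _ => hx i j, hμ',
        ENNReal.ofReal_toReal (μ'.apply_ne_top j)]
    · rw [PMF.mem_support_iff, PMF.ofFintype_apply] at hp
      refine hM _ _ fun h => hp ?_
      rw [h, ENNReal.ofReal_zero]

/-- The independent coupling. It serves probabilistic vertices none of whose successors has to be
avoided. -/
theorem transport_true (μ : PMF S) (μ' : PMF S') : Transport (fun _ _ => True) μ μ' :=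
  ⟨fun i j => (μ i).toReal * (μ' j).toReal, fun _ _ => by positivity,
    fun i => by rw [← Finset.mul_sum, sum_toReal, mul_one],
    fun j => by rw [← Finset.sum_mul, sum_toReal, one_mul], fun _ _ _ => trivial⟩

/-- A nonnegative matrix with these marginals vanishes off the supports, so the relations need to be
compared only there. -/
theorem Transport.mono {M M' : S → S' → Prop} {μ : PMF S} {μ' : PMF S'} (h : Transport M μ μ')
    (hM : ∀ t ∈ μ.support, ∀ t' ∈ μ'.support, M t t' → M' t t') : Transport M' μ μ' := by
  obtain ⟨x, hx, hμ, hμ', hx'⟩ := h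
  refine ⟨x, hx, hμ, hμ', fun i j hij => hM i (fun h => hij ?_) j (fun h => hij ?_) (hx' i j hij)⟩
  · have := hμ i
    rw [h, ENNReal.toReal_zero, Finset.sum_eq_zero_iff_of_nonneg fun j _ => hx i j] at this
    exact this j (Finset.mem_univ _)
  · have := hμ' j
    rw [h, ENNReal.toReal_zero, Finset.sum_eq_zero_iff_of_nonneg fun i _ => hx i j] at this
    exact this i (Finset.mem_univ _)

/-- Extension by zero and restriction to the supports are the two directions. A sum of nonnegative
entries is `0` exactly if every entry is. -/
theorem exists_solvesEq_iff {Sig Flt : Type} (μ : PMF S) (μ' : PMF S')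
    (C : Set (SymVertex S S' Sig Flt)) :
    (∃ x, SolvesEq μ μ' C x) ↔ Transport (fun s s' => SymVertex.ref s s' ∉ C) μ μ' := by
  classical
  constructor
  · rintro ⟨x, hx⟩
    let y : S → S' → ℝ := fun i j =>
      if h : i ∈ μ.support ∧ j ∈ μ'.support then x ⟨i, h.1⟩ ⟨j, h.2⟩ else 0
    have hy : ∀ (i : μ.support) (j : μ'.support), y i j = x i j := fun i j =>
      dif_pos ⟨i.2, j.2⟩
    have hy₁ : ∀ i j, i ∉ μ.support → y i j = 0 := fun i j h => dif_neg fun h' => h h'.1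
    have hy₂ : ∀ i j, j ∉ μ'.support → y i j = 0 := fun i j h => dif_neg fun h' => h h'.2
    refine ⟨y, fun i j => ?_, fun i => ?_, fun j => ?_, fun i j hij hC => hij ?_⟩
    · change 0 ≤ dite _ _ _
      split_ifs
      exacts [hx.nonneg _ _, le_rfl]
    · by_cases hi : i ∈ μ.support
      · have := (hx.row ⟨i, hi⟩).unique (hasSum_fintype _)
        rw [this, ← Finset.sum_subset (Finset.subset_univ (Finset.univ.filter (· ∈ μ'.support)))
          fun j _ hj => hy₂ i j (by simpa using hj)]
        rw [Finset.sum_subtype (p := (· ∈ μ'.support)) _ (by simp)]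
        exact Finset.sum_congr rfl fun j _ => hy ⟨i, hi⟩ j
      · rw [Finset.sum_eq_zero fun j _ => hy₁ i j hi, (μ.apply_eq_zero_iff i).2 hi,
          ENNReal.toReal_zero]
    · by_cases hj : j ∈ μ'.support
      · have := (hx.col ⟨j, hj⟩).unique (hasSum_fintype _)
        rw [this, ← Finset.sum_subset (Finset.subset_univ (Finset.univ.filter (· ∈ μ.support)))
          fun i _ hi => hy₁ i j (by simpa using hi)]
        rw [Finset.sum_subtype (p := (· ∈ μ.support)) _ (by simp)]
        exact Finset.sum_congr rfl fun i _ => hy i ⟨j, hj⟩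
      · rw [Finset.sum_eq_zero fun i _ => hy₂ i j hj, (μ'.apply_eq_zero_iff j).2 hj,
          ENNReal.toReal_zero]
    · by_cases h : i ∈ μ.support ∧ j ∈ μ'.support
      · have := hx.avoid
        rw [hasSum_zero_iff_of_nonneg fun _ => hx.nonneg _ _] at this
        exact (hy ⟨i, h.1⟩ ⟨j, h.2⟩).trans (congrFun this ⟨(⟨i, h.1⟩, ⟨j, h.2⟩), hC⟩)
      · exact dif_neg h
  · rintro ⟨x, hx, hμ, hμ', hC⟩
    have hx₁ : ∀ i j, i ∉ μ.support → x i j = 0 := by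
      intro i j hi
      have := hμ i
      rw [(μ.apply_eq_zero_iff i).2 hi, ENNReal.toReal_zero,
        Finset.sum_eq_zero_iff_of_nonneg fun j _ => hx i j] at this
      exact this j (Finset.mem_univ _)
    have hx₂ : ∀ i j, j ∉ μ'.support → x i j = 0 := by
      intro i j hj
      have := hμ' j
      rw [(μ'.apply_eq_zero_iff j).2 hj, ENNReal.toReal_zero,
        Finset.sum_eq_zero_iff_of_nonneg fun i _ => hx i j] at this
      exact this i (Finset.mem_univ _)
    refine ⟨fun i j => x i j, fun _ _ => hx _ _, fun i => ?_, fun j => ?_, ?_⟩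
    · convert hasSum_fintype fun j : μ'.support => x i j using 1
      rw [← hμ, ← Finset.sum_subset (Finset.subset_univ (Finset.univ.filter (· ∈ μ'.support)))
        fun j _ hj => hx₂ i j (by simpa using hj)]
      rw [Finset.sum_subtype (p := (· ∈ μ'.support)) _ (by simp)]
    · convert hasSum_fintype fun i : μ.support => x i j using 1
      rw [← hμ', ← Finset.sum_subset (Finset.subset_univ (Finset.univ.filter (· ∈ μ.support)))
        fun i _ hi => hx₁ i j (by simpa using hi)]
      rw [Finset.sum_subtype (p := (· ∈ μ.support)) _ (by simp)]
    · convert hasSum_zero using 1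
      funext q
      by_contra h
      exact hC _ _ h q.2

end Transport

/-! ## The symbolic game -/

section Game

variable {S S' Sig Flt : Type} (A : PTS S Sig) (A' : PTS S' (Sig ⊕ Flt))

/-- The conditions of a masking simulation at one pair of states. -/
structure Simulates (M : S → S' → Prop) (s : S) (s' : S') : Prop where
  nominal : ∀ (e : Sig) (μ : PMF S), A.trans s e μ →
    ∃ μ', A'.trans s' (Sum.inl e) μ' ∧ LiftRel M μ μ'
  implementation : ∀ (e : Sig) (μ' : PMF S'), A'.trans s' (Sum.inl e) μ' →
    ∃ μ, A.trans s e μ ∧ LiftRel M μ μ'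
  fault : ∀ (F : Flt) (μ' : PMF S'), A'.trans s' (Sum.inr F) μ' → LiftRel M (PMF.pure s) μ'

variable {A A'}

theorem LiftRel.mono {M M' : S → S' → Prop} (h : ∀ s s', M s s' → M' s s') {μ : PMF S}
    {μ' : PMF S'} : LiftRel M μ μ' → LiftRel M' μ μ' :=
  fun ⟨w, hw, hM⟩ => ⟨w, hw, fun q hq => h _ _ (hM q hq)⟩

theorem Simulates.mono {M M' : S → S' → Prop} (h : ∀ s s', M s s' → M' s s') {s : S} {s' : S'}
    (hs : Simulates A A' M s s') : Simulates A A' M' s s' where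
  nominal e μ hμ := (hs.nominal e μ hμ).imp fun _ ⟨h₁, h₂⟩ => ⟨h₁, h₂.mono h⟩
  implementation e μ hμ := (hs.implementation e μ hμ).imp fun _ ⟨h₁, h₂⟩ => ⟨h₁, h₂.mono h⟩
  fault F μ hμ := (hs.fault F μ hμ).mono h

theorem maskingLE_iff : MaskingLE A A' ↔
    ∃ M : S → S' → Prop, (∀ s s', M s s' → Simulates A A' M s s') ∧ M A.init A'.init :=
  ⟨fun ⟨M, h⟩ => ⟨M, fun s s' hs => ⟨h.nominal s s' hs, h.implementation s s' hs,
    h.fault s s' hs⟩, h.init⟩, fun ⟨M, h, h'⟩ => ⟨M, h', fun s s' hs => (h s s' hs).nominal,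
    fun s s' hs => (h s s' hs).implementation, fun s s' hs => (h s s' hs).fault⟩⟩

variable (A A') in
/-- The vertices from which the Verifier can keep to `M`. -/
def Safe (M : S → S' → Prop) : SymVertex S S' Sig Flt → Prop
  | .err => False
  | .ref s s' => M s s'
  | .ver₁ s σ s' μ => ∃ μ', A.trans s σ μ ∧ A'.trans s' (Sum.inl σ) μ' ∧ LiftRel M μ μ'
  | .ver₂ s (.inl σ) s' μ' => ∃ μ, A.trans s σ μ ∧ A'.trans s' (Sum.inl σ) μ' ∧ LiftRel M μ μ'
  | .ver₂ s (.inr F) s' μ' => A'.trans s' (Sum.inr F) μ' ∧ LiftRel M (PMF.pure s) μ'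
  | .prob _ _ μ μ' => LiftRel M μ μ'

/-- No stage can be the first to contain a safe vertex: the Refuter's moves from safe vertices stay
safe, the Verifier always has a safe move, and at a probabilistic vertex the coupling solves the
system. -/
theorem not_mem_symU_of_safe [Fintype S] [Fintype S'] {M : S → S' → Prop}
    (hM : ∀ s s', M s s' → Simulates A A' M s s') (i : ℕ) (v : SymVertex S S' Sig Flt)
    (hv : Safe A A' M v) : v ∉ symU A A' i := by
  induction i using Nat.strong_induction_on generalizing v with
  | _ i ih =>
  rcases i with _ | i
  · rw [symU]
    rintro rfl
    exact hv
  rw [symU]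
  rintro ((⟨hr, u, hu, hui⟩ | ⟨hver, hsub, -⟩) | ⟨s, s', μ, μ', rfl, -, hno⟩)
  · rcases hr with rfl | ⟨s, s', rfl⟩
    · exact hv
    have hs := hM s s' hv
    refine ih i (Nat.lt_succ_self i) u ?_ hui
    rcases hu with hu | ⟨-, h | h, -⟩
    · cases hu with
      | refute₁ h =>
        obtain ⟨μ', h₁, h₂⟩ := hs.nominal _ _ h
        exact ⟨μ', h, h₁, h₂⟩
      | @refute₂ _ _ σ _ h =>
        rcases σ with σ | F
        · obtain ⟨μ, h₁, h₂⟩ := hs.implementation _ _ h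
          exact ⟨μ, h₁, h, h₂⟩
        · exact ⟨h, hs.fault _ _ h⟩
    · rcases h with ⟨_, _, _, _, -, h⟩ | ⟨_, _, _, _, -, h⟩ <;> cases h
    · cases h
  · have key : ∃ u, SymMove A A' v u ∧ Safe A A' M u := by
      rcases hver with ⟨s, σ, s', μ, h, rfl⟩ | ⟨s, σ, s', μ', h, rfl⟩
      · obtain ⟨μ', h₁, h₂, h₃⟩ := hv
        exact ⟨_, .verify₁ h₁ h₂, h₃⟩
      · rcases σ with σ | F
        · obtain ⟨μ, h₁, h₂, h₃⟩ := hv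
          exact ⟨_, .verify₂ h₂ h₁, h₃⟩
        · exact ⟨_, .mask hv.1, hv.2⟩
    obtain ⟨u, hu, hs⟩ := key
    obtain ⟨j, hj⟩ := Set.mem_iUnion.1 (hsub (.inl hu))
    exact ih j.1 j.2 u hs hj
  · refine hno ((exists_solvesEq_iff _ _ _).2 ?_)
    refine ((liftRel_iff_transport _ _ _).1 hv).mono fun t _ t' _ h hC => ?_
    exact ih i (Nat.lt_succ_self i) (.ref t t') h hC.2

theorem err_mem_symU (i : ℕ) : SymVertex.err ∈ symU A A' i := by
  induction i with
  | zero => rw [symU]; rfl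
  | succ i ih =>
    rw [symU]
    refine .inl (.inl ⟨.inl rfl, .err, .inr ⟨rfl, .inr rfl, ?_⟩, ih⟩)
    rintro ⟨u, -, hu⟩
    cases hu

/-- The loop at the error vertex starts the induction. A larger stage forbids more pairs, so an
unsolvable system stays unsolvable. -/
theorem symU_subset_succ [Fintype S] [Fintype S'] (i : ℕ) : symU A A' i ⊆ symU A A' (i + 1) := by
  induction i with
  | zero =>
    rw [symU]
    rintro v rfl
    exact err_mem_symU 1
  | succ i ih =>
    intro v hv
    rw [symU] at hv ⊢
    rcases hv with (⟨hr, u, hu, hui⟩ | ⟨hver, hsub, u, hu, hui⟩) |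
      ⟨s, s', μ, μ', rfl, ⟨u, hu, hui⟩, hno⟩
    · exact .inl (.inl ⟨hr, u, hu, ih hui⟩)
    · refine .inl (.inr ⟨hver, fun w hw => ?_, u, hu, ih hui⟩)
      obtain ⟨j, hj⟩ := Set.mem_iUnion.1 (hsub hw)
      exact Set.mem_iUnion.2 ⟨⟨j.1, by omega⟩, hj⟩
    · refine .inr ⟨s, s', μ, μ', rfl, ⟨u, hu, ih hui⟩, fun h => hno ?_⟩
      rw [exists_solvesEq_iff] at h ⊢
      exact h.mono fun t _ t' _ h h' => h ⟨h'.1, ih h'.2⟩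

theorem symU_mono [Fintype S] [Fintype S'] : Monotone (symU A A') :=
  monotone_nat_of_le_succ symU_subset_succ

theorem exists_subset_symU [Fintype S] [Fintype S'] {F : Set (SymVertex S S' Sig Flt)}
    (hF : F.Finite) (h : F ⊆ symUSet A A') : ∃ i, F ⊆ symU A A' i := by
  induction F, hF using Set.Finite.induction_on with
  | empty => exact ⟨0, Set.empty_subset _⟩
  | @insert v F _ _ ih =>
    obtain ⟨i, hi⟩ := ih ((Set.subset_insert _ _).trans h)
    obtain ⟨j, hj⟩ := Set.mem_iUnion.1 (h (Set.mem_insert _ _))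
    refine ⟨max i j, Set.insert_subset (symU_mono (le_max_right i j) hj)
      (hi.trans (symU_mono (le_max_left i j)))⟩

/-- There are finitely many state pairs, so one stage `i` contains all those in `symUSet`. As the
vertex is not in stage `i + 1`, there is a coupling that avoids them all. -/
theorem liftRel_of_prob_not_mem [Fintype S] [Fintype S'] {s : S} {s' : S'} {μ : PMF S}
    {μ' : PMF S'} (h : SymVertex.prob s s' μ μ' ∉ symUSet A A') :
    LiftRel (fun t t' => SymVertex.ref t t' ∉ symUSet A A') μ μ' := by
  obtain ⟨i, hi⟩ := exists_subset_symU (A := A) (A' := A')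
    (F := (Set.range fun q : S × S' => SymVertex.ref q.1 q.2) ∩ symUSet A A')
    ((Set.finite_range _).inter_of_left _) Set.inter_subset_right
  have hi : ∀ t t', SymVertex.ref t t' ∈ symUSet A A' → SymVertex.ref t t' ∈ symU A A' i :=
    fun t t' h => hi ⟨⟨(t, t'), rfl⟩, h⟩
  have hpost : ∀ t ∈ μ.support, ∀ t' ∈ μ'.support,
      SymVertex.ref t t' ∈ symPost A A' (.prob s s' μ μ') := fun t ht t' ht' => .inl (.draw ht ht')
  rw [liftRel_iff_transport]
  by_cases hne : (symPost A A' (.prob s s' μ μ') ∩ symU A A' i).Nonempty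
  · have hx : ∃ x, SolvesEq μ μ' (symPost A A' (.prob s s' μ μ') ∩ symU A A' i) x := by
      by_contra hx
      refine h (Set.mem_iUnion.2 ⟨i + 1, ?_⟩)
      rw [symU]
      exact .inr ⟨s, s', μ, μ', rfl, hne, hx⟩
    exact ((exists_solvesEq_iff _ _ _).1 hx).mono fun t ht t' ht' hC hU =>
      hC ⟨hpost t ht t' ht', hi t t' hU⟩
  · exact (transport_true μ μ').mono fun t ht t' ht' _ hU =>
      hne ⟨_, hpost t ht t' ht', hi t t' hU⟩

/-- If all moves led into `symUSet`, then by finite branching a single stage would contain them, and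
`v` would belong to the next one. -/
theorem exists_move_of_not_mem [Fintype S] [Fintype S'] {v : SymVertex S S' Sig Flt}
    (hv : v ∈ verifierVertices A A') (hfin : {u | SymMove A A' v u}.Finite)
    (h : v ∉ symUSet A A') : ∃ u, SymMove A A' v u ∧ u ∉ symUSet A A' := by
  by_contra! hcon
  have hsub : symPost A A' v ⊆ symUSet A A' := by
    rintro u (hu | ⟨rfl, -⟩)
    · exact hcon u hu
    · exact Set.mem_iUnion.2 ⟨0, err_mem_symU 0⟩
  have hfin' : (symPost A A' v).Finite := by
    refine (hfin.union (Set.finite_singleton .err)).subset ?_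
    rintro u (hu | ⟨rfl, -⟩)
    exacts [.inl hu, .inr rfl]
  obtain ⟨i, hi⟩ := exists_subset_symU hfin' hsub
  -- A Verifier's vertex without moves still has the error vertex as a successor.
  have hne : (symPost A A' v).Nonempty := by
    by_cases hu : ∃ u', u' ≠ .err ∧ SymMove A A' v u'
    · obtain ⟨u, -, hu⟩ := hu
      exact ⟨u, .inl hu⟩
    · exact ⟨.err, .inr ⟨rfl, .inl hv, hu⟩⟩
  refine h (Set.mem_iUnion.2 ⟨i + 1, ?_⟩)
  rw [symU]
  refine .inl (.inr ⟨hv, fun u hu => Set.mem_iUnion.2 ⟨⟨i, by omega⟩, hi hu⟩, ?_⟩)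
  obtain ⟨u, hu⟩ := hne
  exact ⟨u, hu, hi hu⟩

theorem simulates_of_ref_not_mem [Fintype S] [Fintype S']
    (hA : ∀ s σ, {μ | A.trans s σ μ}.Finite) (hA' : ∀ s' σ, {μ' | A'.trans s' σ μ'}.Finite)
    {s : S} {s' : S'} (h : SymVertex.ref s s' ∉ symUSet A A') :
    Simulates A A' (fun t t' => SymVertex.ref t t' ∉ symUSet A A') s s' := by
  have hstep : ∀ v, SymMove A A' (.ref s s') v → v ∉ symUSet A A' := by
    intro v hv hU
    obtain ⟨i, hi⟩ := Set.mem_iUnion.1 hU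
    refine h (Set.mem_iUnion.2 ⟨i + 1, ?_⟩)
    rw [symU]
    exact .inl (.inl ⟨.inr ⟨s, s', rfl⟩, v, .inl hv, hi⟩)
  refine ⟨fun e μ hμ => ?_, fun e μ' hμ' => ?_, fun F μ' hμ' => ?_⟩
  · obtain ⟨u, hu, hU⟩ := exists_move_of_not_mem (.inl ⟨_, _, _, _, hμ, rfl⟩)
      (((hA' s' (.inl e)).image fun μ' => SymVertex.prob s s' μ μ').subset (by
        intro u hu
        cases hu with
        | verify₁ h₁ h₂ => exact ⟨_, h₂, rfl⟩)) (hstep _ (.refute₁ hμ))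
    cases hu with
    | verify₁ h₁ h₂ => exact ⟨_, h₂, liftRel_of_prob_not_mem hU⟩
  · obtain ⟨u, hu, hU⟩ := exists_move_of_not_mem (.inr ⟨_, _, _, _, hμ', rfl⟩)
      (((hA s e).image fun μ => SymVertex.prob s s' μ μ').subset (by
        intro u hu
        cases hu with
        | verify₂ h₁ h₂ => exact ⟨_, h₂, rfl⟩)) (hstep _ (.refute₂ hμ'))
    cases hu with
    | verify₂ h₁ h₂ => exact ⟨_, h₂, liftRel_of_prob_not_mem hU⟩
  · obtain ⟨u, hu, hU⟩ := exists_move_of_not_mem (.inr ⟨_, _, _, _, hμ', rfl⟩)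
      ((Set.finite_singleton (SymVertex.prob s s' (PMF.pure s) μ')).subset (by
        intro u hu
        cases hu with
        | mask h₁ => rfl)) (hstep _ (.refute₂ hμ'))
    cases hu with
    | mask h₁ => exact liftRel_of_prob_not_mem hU

/-- The Verifier wins exactly at the pairs that some masking relation contains. -/
theorem ref_not_mem_symUSet_iff [Fintype S] [Fintype S']
    (hA : ∀ s σ, {μ | A.trans s σ μ}.Finite) (hA' : ∀ s' σ, {μ' | A'.trans s' σ μ'}.Finite)
    (s : S) (s' : S') : SymVertex.ref s s' ∉ symUSet A A' ↔
      ∃ M : S → S' → Prop, (∀ t t', M t t' → Simulates A A' M t t') ∧ M s s' := by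
  constructor
  · exact fun h => ⟨_, fun t t' ht => simulates_of_ref_not_mem hA hA' ht, h⟩
  · rintro ⟨M, hM, hs⟩ hU
    obtain ⟨i, hi⟩ := Set.mem_iUnion.1 hU
    exact not_mem_symU_of_safe hM i (.ref s s') hs hi

end Game

/-! ## The transition systems that are presented to the programs -/

/-- A state as a number. -/
def code {n : ℕ} (i : Fin n) : ℤ := (i : ℕ)

theorem code_injective {n : ℕ} : Function.Injective (code (n := n)) := fun i j h =>
  Fin.ext (by simpa [code] using h)

namespace RatDist

variable {n : ℕ} (d : RatDist n)

def supportList : List (Fin n) := (List.finRange n).filter fun i => d.p i ≠ 0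

theorem mem_supportList {i : Fin n} : i ∈ d.supportList ↔ d.p i ≠ 0 := by
  simp [supportList]

theorem nodup_supportList : d.supportList.Nodup := (List.nodup_finRange n).filter _

def entries : DistList :=
  d.supportList.map fun i => (code i, (d.p i).num, ((d.p i).den : ℤ))

theorem enc_entries : enc d.entries = d.encode := by
  change Val.ofList _ = Val.ofList _
  rw [entries, List.map_map]
  rfl

theorem toReal_toPMF (i : Fin n) : (d.toPMF i).toReal = d.p i := by
  rw [toPMF, PMF.ofFintype_apply, ENNReal.toReal_ofReal (by exact_mod_cast d.nonneg i)]

theorem sum_real : ∑ i, (d.p i : ℝ) = 1 := by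
  rw [← Rat.cast_sum, d.sum_eq_one, Rat.cast_one]

theorem denominators_pos : 0 < denominators d.entries := by
  refine List.prod_pos fun a ha => ?_
  simp only [entries, List.map_map, List.mem_map] at ha
  obtain ⟨i, -, rfl⟩ := ha
  exact Int.natCast_pos.2 (d.p i).den_pos

theorem den_mul_cofactor {i : Fin n} (hi : i ∈ d.supportList) :
    ((d.p i).den : ℤ) * cofactor d.entries (code i) = denominators d.entries := by
  have h₁ : denominators d.entries = (d.supportList.map fun i => ((d.p i).den : ℤ)).prod := by
    rw [denominators, entries, List.map_map]
    rfl
  have h₂ : cofactor d.entries (code i) =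
      ((d.supportList.erase i).map fun i => ((d.p i).den : ℤ)).prod := by
    rw [cofactor, entries, List.filter_map, List.map_map, d.nodup_supportList.erase_eq_filter]
    congr 2
    refine List.filter_congr fun j _ => ?_
    by_cases h : j = i <;> simp [code_injective.eq_iff, h]
  rw [h₁, h₂, List.prod_map_erase (fun i => ((d.p i).den : ℤ)) hi]

/-- The scaled probability of `i`. -/
def weight (D : ℤ) (i : Fin n) : ℤ := (d.p i).num * cofactor d.entries (code i) * D

theorem scaled_entries (D : ℤ) :
    scaled d.entries D = d.supportList.map fun i => (code i, d.weight D i) := by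
  rw [scaled]
  nth_rw 2 [entries]
  rw [List.map_map]
  rfl

/-- In a network both distributions are scaled by the same factor, the product of all denominators
of both, which keeps supply and demand balanced. -/
theorem weight_eq (D : ℤ) (i : Fin n) :
    (d.weight D i : ℝ) = d.p i * (denominators d.entries * D : ℤ) := by
  by_cases hi : i ∈ d.supportList
  · have h : (d.p i : ℝ) = (d.p i).num / (d.p i).den := Rat.cast_def _
    have h' : ((d.p i).den : ℝ) ≠ 0 := by exact_mod_cast (d.p i).den_ne_zero
    rw [weight, h, ← d.den_mul_cofactor hi]
    push_cast
    field_simp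
  · have : d.p i = 0 := by simpa [mem_supportList] using hi
    simp [weight, this]

theorem sum_supportList {M : Type} [AddCommMonoid M] (g : Fin n → M)
    (hg : ∀ i, d.p i = 0 → g i = 0) : (d.supportList.map g).sum = ∑ i, g i := by
  rw [← List.sum_toFinset _ d.nodup_supportList]
  refine Finset.sum_subset (Finset.subset_univ _) fun i _ hi => hg i ?_
  simpa [mem_supportList] using hi

theorem sum_keys (D : ℤ) (g : ℤ → ℝ) :
    ∑ k ∈ keys (scaled d.entries D), g k = ∑ i : Fin n, if d.p i ≠ 0 then g (code i) else 0 := by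
  have : keys (scaled d.entries D) = (Finset.univ.filter fun i => d.p i ≠ 0).image code := by
    ext k
    simp [keys, scaled_entries, mem_supportList]
  rw [this, Finset.sum_image fun i _ j _ h => code_injective h, Finset.sum_filter]

theorem mem_keys_scaled {D k : ℤ} :
    k ∈ keys (scaled d.entries D) ↔ ∃ i, d.p i ≠ 0 ∧ code i = k := by
  simp [keys, scaled_entries, mem_supportList]

theorem sum_weight (D : ℤ) :
    ((scaled d.entries D).map fun r => r.2).sum = denominators d.entries * D := by
  rw [scaled_entries, List.map_map]
  have h := d.sum_supportList (d.weight D) fun i hi => by simp [weight, hi]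
  have h' : ((∑ i, d.weight D i : ℤ) : ℝ) = (denominators d.entries * D : ℤ) := by
    rw [Int.cast_sum]
    simp only [weight_eq]
    rw [← Finset.sum_mul, d.sum_real, one_mul]
  exact h.trans (by exact_mod_cast h')

theorem nodup_scaled (D : ℤ) : ((scaled d.entries D).map Prod.fst).Nodup := by
  rw [scaled_entries, List.map_map]
  exact d.nodup_supportList.map code_injective

theorem scaled_nonneg {D : ℤ} (hD : 0 ≤ D) : ∀ r ∈ scaled d.entries D, 0 ≤ r.2 := by
  intro r hr
  rw [scaled_entries] at hr
  obtain ⟨i, -, rfl⟩ := List.mem_map.1 hr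
  have h : (0 : ℝ) ≤ d.weight D i := by
    rw [weight_eq]
    have := d.denominators_pos
    exact mul_nonneg (by exact_mod_cast d.nonneg i) (by exact_mod_cast mul_nonneg this.le hD)
  exact_mod_cast h

end RatDist

open RatDist in
theorem network_valid {n n' : ℕ} (d : RatDist n) (d' : RatDist n') (W : List (ℤ × ℤ)) :
    (network d.entries d'.entries W).Valid where
  nodup_left := d.nodup_scaled _
  nodup_right := d'.nodup_scaled _
  nonneg_left := d.scaled_nonneg d'.denominators_pos.le
  nonneg_right := d'.scaled_nonneg d.denominators_pos.le
  balanced := (d.sum_weight _).trans ((mul_comm _ _).trans (d'.sum_weight _).symm)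

/-- Solutions of the scaled problem and transport matrices differ by the factor `D * D'` and the
renaming of states by `code`. -/
theorem feasible_network_iff {n n' : ℕ} (d : RatDist n) (d' : RatDist n') (W : List (ℤ × ℤ)) :
    feasible (network d.entries d'.entries W) = true ↔
      LiftRel (fun i j => memPair W (code i) (code j) = true) d.toPMF d'.toPMF := by
  classical
  rw [feasible_iff (network_valid d d' W), liftRel_iff_transport]
  set D := denominators d.entries with hD
  set D' := denominators d'.entries with hD'
  have hpos : (0 : ℝ) < (D * D' : ℤ) := by
    exact_mod_cast mul_pos d.denominators_pos d'.denominators_pos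
  have hcomm : (D' * D : ℤ) = D * D' := mul_comm _ _
  change (∃ x : ℤ → ℤ → ℝ, (∀ i ∈ keys (scaled d.entries D'), ∀ j ∈ keys (scaled d'.entries D),
      0 ≤ x i j) ∧
    (∀ r ∈ scaled d.entries D', ∑ j ∈ keys (scaled d'.entries D), x r.1 j = r.2) ∧
    (∀ c ∈ scaled d'.entries D, ∑ i ∈ keys (scaled d.entries D'), x i c.1 = c.2) ∧
    ∀ i ∈ keys (scaled d.entries D'), ∀ j ∈ keys (scaled d'.entries D), x i j ≠ 0 →
      memPair W i j = true) ↔ _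
  simp only [RatDist.scaled_entries d, RatDist.scaled_entries d', List.forall_mem_map,
    RatDist.weight_eq]
  simp only [← RatDist.scaled_entries, RatDist.mem_supportList, RatDist.mem_keys_scaled,
    forall_exists_index, and_imp, forall_apply_eq_imp_iff₂, ← hD, ← hD', hcomm,
    RatDist.sum_keys]
  constructor
  · rintro ⟨x, hx₀, hx₁, hx₂, hx₃⟩
    obtain ⟨y, hy⟩ : ∃ y : Fin n → Fin n' → ℝ, ∀ i j, y i j =
        if d.p i ≠ 0 then if d'.p j ≠ 0 then x (code i) (code j) / (D * D' : ℤ) else 0 else 0 :=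
      ⟨_, fun _ _ => rfl⟩
    refine ⟨y, fun i j => ?_, fun i => ?_, fun j => ?_, fun i j h => ?_⟩
    · rw [hy]
      split_ifs with h h'
      · exact div_nonneg (hx₀ i h j h') hpos.le
      · exact le_rfl
      · exact le_rfl
    · rw [RatDist.toReal_toPMF]
      by_cases hi : d.p i ≠ 0
      · have := hx₁ i hi
        rw [← div_eq_iff hpos.ne', Finset.sum_div] at this
        rw [← this]
        refine Finset.sum_congr rfl fun j _ => ?_
        rw [hy, if_pos hi, ite_div, zero_div]
      · simp only [hy, if_neg hi, Finset.sum_const_zero]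
        rw [not_not.1 hi, Rat.cast_zero]
    · rw [RatDist.toReal_toPMF]
      by_cases hj : d'.p j ≠ 0
      · have := hx₂ j hj
        rw [← div_eq_iff hpos.ne', Finset.sum_div] at this
        rw [← this]
        refine Finset.sum_congr rfl fun i _ => ?_
        rw [hy, if_pos hj, ite_div, zero_div]
      · simp only [hy, if_neg hj, ite_self, Finset.sum_const_zero]
        rw [not_not.1 hj, Rat.cast_zero]
    · rw [hy] at h
      split_ifs at h with hi hj
      · exact hx₃ i hi j hj fun h' => h (by rw [h', zero_div])
      · exact absurd rfl h
      · exact absurd rfl h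
  · rintro ⟨y, hy₀, hy₁, hy₂, hy₃⟩
    -- Only the values at codes of states matter; elsewhere `x` is arbitrary.
    obtain ⟨x, hx⟩ : ∃ x : ℤ → ℤ → ℝ, ∀ (i : Fin n) (j : Fin n'),
        x (code i) (code j) = y i j * (D * D' : ℤ) :=
      ⟨fun a b => if h : a.toNat < n ∧ b.toNat < n' then
        y ⟨a.toNat, h.1⟩ ⟨b.toNat, h.2⟩ * (D * D' : ℤ) else 0, fun i j => by simp [code]⟩
    simp only [RatDist.toReal_toPMF] at hy₁ hy₂
    have hz₁ : ∀ i j, d.p i = 0 → y i j = 0 := by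
      intro i j hi
      have := hy₁ i
      rw [hi, Rat.cast_zero, Finset.sum_eq_zero_iff_of_nonneg fun j _ => hy₀ i j] at this
      exact this j (Finset.mem_univ _)
    have hz₂ : ∀ i j, d'.p j = 0 → y i j = 0 := by
      intro i j hj
      have := hy₂ j
      rw [hj, Rat.cast_zero, Finset.sum_eq_zero_iff_of_nonneg fun i _ => hy₀ i j] at this
      exact this i (Finset.mem_univ _)
    refine ⟨x, fun i _ j _ => ?_, fun i hi => ?_, fun j hj => ?_, fun i _ j _ h => hy₃ i j ?_⟩
    · rw [hx]
      exact mul_nonneg (hy₀ i j) hpos.le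
    · rw [← hy₁, Finset.sum_mul]
      refine Finset.sum_congr rfl fun j _ => ?_
      split_ifs with hj
      · exact hx i j
      · rw [hz₂ i j (not_not.1 hj), zero_mul]
    · rw [← hy₂, Finset.sum_mul]
      refine Finset.sum_congr rfl fun i _ => ?_
      split_ifs with hi
      · exact hx i j
      · rw [hz₁ i j (not_not.1 hi), zero_mul]
    · intro h'
      exact h (by rw [hx, h', zero_mul])

namespace RatDist

/-- The point mass. -/
def dirac {n : ℕ} (s : Fin n) : RatDist n where
  p := Pi.single s 1
  nonneg i := by
    rw [Pi.single_apply]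
    split_ifs <;> norm_num
  sum_eq_one := by simp

theorem toPMF_dirac {n : ℕ} (s : Fin n) : (dirac s).toPMF = PMF.pure s := by
  ext i
  rw [toPMF, PMF.ofFintype_apply, PMF.pure_apply]
  change ENNReal.ofReal ((Pi.single s 1 : Fin n → ℚ) i : ℝ) = _
  rw [Pi.single_apply]
  split_ifs <;> simp

theorem entries_dirac {n : ℕ} (s : Fin n) : (dirac s).entries = [(code s, 1, 1)] := by
  have h : (dirac s).supportList = [s] := by
    have h₁ := (dirac s).nodup_supportList
    have h₂ : ∀ i, i ∈ (dirac s).supportList ↔ i ∈ [s] := by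
      intro i
      simp [mem_supportList, dirac, Pi.single_apply]
    exact List.perm_singleton.1 ((List.perm_ext_iff_of_nodup h₁ (by simp)).2 h₂)
  rw [entries, h]
  simp [dirac]

end RatDist

def nominalList (A : FinPTS ℕ) : NominalList :=
  A.trans.map fun τ => (code τ.1, (τ.2.1 : ℤ), τ.2.2.entries)

def label : ℕ ⊕ ℕ → ℤ × ℤ
  | .inl a => (0, a)
  | .inr F => (1, F)

def implList (A' : FinPTS (ℕ ⊕ ℕ)) : ImplList :=
  A'.trans.map fun τ => (code τ.1, label τ.2.1, τ.2.2.entries)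

theorem enc_nominalList (A : FinPTS ℕ) : enc (nominalList A) = A.encodeTrans actionVal := by
  change Val.ofList _ = Val.ofList _
  rw [nominalList, List.map_map]
  congr 2
  funext τ
  change Val.pair _ (Val.pair _ (enc τ.2.2.entries)) = _
  rw [RatDist.enc_entries]
  rfl

theorem enc_label (l : ℕ ⊕ ℕ) : enc (label l) = labelVal l := by
  cases l <;> rfl

theorem enc_implList (A' : FinPTS (ℕ ⊕ ℕ)) : enc (implList A') = A'.encodeTrans labelVal := by
  change Val.ofList _ = Val.ofList _
  rw [implList, List.map_map]
  congr 2
  funext τ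
  change Val.pair _ (Val.pair (enc (label τ.2.1)) (enc τ.2.2.entries)) = _
  rw [RatDist.enc_entries, enc_label]
  rfl

/-- The input of the programs. -/
abbrev Input := (ℤ × ℤ × NominalList) × ℤ × ℤ × ImplList

def input (A : FinPTS ℕ) (A' : FinPTS (ℕ ⊕ ℕ)) : Input :=
  ((A.n, code A.init, nominalList A), A'.n, code A'.init, implList A')

theorem enc_input (A : FinPTS ℕ) (A' : FinPTS (ℕ ⊕ ℕ)) : enc (input A A') = inputVal A A' := by
  change Val.pair (Val.pair _ (Val.pair _ (enc (nominalList A))))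
    (Val.pair _ (Val.pair _ (enc (implList A')))) = _
  rw [enc_nominalList, enc_implList]
  rfl

/-! ### Correctness of the two programs -/

section Correctness

variable (A : FinPTS ℕ) (A' : FinPTS (ℕ ⊕ ℕ)) (W : List (ℤ × ℤ))

/-- The relation that is given by a list of pairs. -/
def relOf {n n' : ℕ} (W : List (ℤ × ℤ)) (s : Fin n) (s' : Fin n') : Prop :=
  memPair W (code s) (code s') = true

theorem simulates_iff (s : Fin A.n) (s' : Fin A'.n) :
    (simulatesNominal (nominalList A) (implList A') W (code s) (code s') = true ∧
      simulatesImpl (nominalList A) (implList A') W (code s) (code s') = true) ↔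
    Simulates A.toPTS A'.toPTS (relOf W) s s' := by
  have hf : ∀ {n n' : ℕ} (d : RatDist n) (d' : RatDist n'),
      feasible (network d.entries d'.entries W) = true ↔ LiftRel (relOf W) d.toPMF d'.toPMF :=
    fun d d' => feasible_network_iff d d' W
  have hn : simulatesNominal (nominalList A) (implList A') W (code s) (code s') = true ↔
      ∀ (e : ℕ) (μ : PMF (Fin A.n)), A.toPTS.trans s e μ →
        ∃ μ', A'.toPTS.trans s' (Sum.inl e) μ' ∧ LiftRel (relOf W) μ μ' := by
    simp only [simulatesNominal, nominalList, implList, List.all_map, List.any_map,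
      Function.comp_def, List.all_eq_true, List.any_eq_true,
      Bool.or_eq_true, Bool.and_eq_true, Bool.not_eq_true',
      decide_eq_true_eq, decide_eq_false_iff_not, code_injective.eq_iff]
    constructor
    · rintro h e _ ⟨d, hd, rfl⟩
      rcases h _ hd with h | ⟨⟨t', l, d'⟩, hτ', h₁, h₂, h₃, h₄⟩
      · exact absurd rfl h
      · obtain rfl : t' = s' := h₁
        rcases l with a | F
        · obtain rfl : a = e := by simpa [label] using h₃
          exact ⟨_, ⟨d', hτ', rfl⟩, (hf _ _).1 h₄⟩
        · simp [label] at h₂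
    · rintro h ⟨t, e, d⟩ hτ
      by_cases ht : t = s
      · subst ht
        obtain ⟨_, ⟨d', hd', rfl⟩, hl⟩ := h e _ ⟨d, hτ, rfl⟩
        exact .inr ⟨_, hd', rfl, rfl, rfl, (hf _ _).2 hl⟩
      · exact .inl ht
  have hi : simulatesImpl (nominalList A) (implList A') W (code s) (code s') = true ↔
      (∀ (e : ℕ) (μ' : PMF (Fin A'.n)), A'.toPTS.trans s' (Sum.inl e) μ' →
        ∃ μ, A.toPTS.trans s e μ ∧ LiftRel (relOf W) μ μ') ∧
      ∀ (F : ℕ) (μ' : PMF (Fin A'.n)), A'.toPTS.trans s' (Sum.inr F) μ' →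
        LiftRel (relOf W) (PMF.pure s) μ' := by
    simp only [simulatesImpl, nominalList, implList, List.all_map, List.any_map,
      Function.comp_def, List.all_eq_true, List.any_eq_true,
      Bool.or_eq_true, Bool.and_eq_true, Bool.not_eq_true',
      decide_eq_true_eq, decide_eq_false_iff_not, code_injective.eq_iff, ← RatDist.entries_dirac,
      ← RatDist.toPMF_dirac, hf]
    constructor
    · intro h
      constructor
      · rintro e _ ⟨d', hd', rfl⟩
        rcases h _ hd' with h | ⟨-, ⟨t, a, d⟩, hτ, h₁, h₂, h₃⟩ | ⟨h, -⟩
        · exact absurd rfl h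
        · obtain rfl : t = s := h₁
          obtain rfl : a = e := by simpa [label] using h₂
          exact ⟨_, ⟨d, hτ, rfl⟩, h₃⟩
        · exact absurd rfl h
      · rintro F _ ⟨d', hd', rfl⟩
        rcases h _ hd' with h | ⟨h, -⟩ | ⟨-, h⟩
        · exact absurd rfl h
        · simp [label] at h
        · exact h
    · rintro ⟨h, h'⟩ ⟨t', l, d'⟩ hτ'
      by_cases ht : t' = s'
      · subst ht
        refine .inr ?_
        rcases l with e | F
        · obtain ⟨_, ⟨d, hd, rfl⟩, hl⟩ := h e _ ⟨d', hτ', rfl⟩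
          exact .inl ⟨rfl, _, hd, rfl, rfl, hl⟩
        · exact .inr ⟨by simp [label], h' F _ ⟨d', hτ', rfl⟩⟩
      · exact .inl ht
  rw [hn, hi]
  exact ⟨fun h => ⟨h.1, h.2.1, h.2.2⟩, fun h => ⟨h.1, h.2, h.3⟩⟩

theorem relOf_refineRel (s : Fin A.n) (s' : Fin A'.n) :
    relOf (refineRel (nominalList A) (implList A') W) s s' ↔
      relOf W s s' ∧ Simulates A.toPTS A'.toPTS (relOf W) s s' := by
  rw [← simulates_iff]
  simp only [relOf, memPair_iff, refineRel, List.mem_filter, Bool.and_eq_true]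

theorem relOf_statePairs (s : Fin A.n) (s' : Fin A'.n) :
    relOf (statePairs (nominalList A) (implList A')) s s' := by
  rw [relOf, memPair_iff]
  obtain ⟨τ, hτ, rfl⟩ := A.serial s
  obtain ⟨τ', hτ', rfl⟩ := A'.serial s'
  exact List.mem_product.2 ⟨List.mem_map.2 ⟨_, List.mem_map.2 ⟨τ, hτ, rfl⟩, rfl⟩,
    List.mem_map.2 ⟨_, List.mem_map.2 ⟨τ', hτ', rfl⟩, rfl⟩⟩

/-- Being a fixed point of the refinement, `winning` is itself closed. Any closed `M` survives each
round because `Simulates` is monotone in the relation. -/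
theorem relOf_winning_iff (s : Fin A.n) (s' : Fin A'.n) :
    relOf (winning (nominalList A) (implList A')) s s' ↔
      ∃ M : Fin A.n → Fin A'.n → Prop,
        (∀ t t', M t t' → Simulates A.toPTS A'.toPTS M t t') ∧ M s s' := by
  constructor
  · refine fun h => ⟨_, fun t t' ht => ?_, h⟩
    rw [← refineRel_winning, relOf_refineRel] at ht
    exact ht.2
  · rintro ⟨M, hM, hs⟩
    have key : ∀ (l : List (ℤ × ℤ)) (W : List (ℤ × ℤ)), (∀ t t', M t t' → relOf W t t') →
        ∀ t t', M t t' →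
          relOf (l.foldl (fun W _ => refineRel (nominalList A) (implList A') W) W) t t' := by
      intro l
      induction l with
      | nil => exact fun _ h => h
      | cons a l ih =>
        intro W hW
        refine ih _ fun t t' ht => ?_
        rw [relOf_refineRel]
        exact ⟨hW t t' ht, (hM t t' ht).mono hW⟩
    exact key _ _ (fun t t' _ => relOf_statePairs A A' t t') s s' hs

theorem finite_trans {L : Type} (D : FinPTS L) (s : Fin D.n) (a : L) :
    {μ | D.toPTS.trans s a μ}.Finite := by
  refine ((List.finite_toSet D.trans).image fun τ => τ.2.2.toPMF).subset ?_
  rintro _ ⟨d, hd, rfl⟩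
  exact ⟨_, hd, rfl⟩

theorem relOf_winning_iff_not_mem (s : Fin A.n) (s' : Fin A'.n) :
    relOf (winning (nominalList A) (implList A')) s s' ↔
      SymVertex.ref s s' ∉ symUSet A.toPTS A'.toPTS := by
  rw [relOf_winning_iff,
    ref_not_mem_symUSet_iff (finite_trans A) (finite_trans A')]

theorem relOf_winning_init_iff :
    relOf (winning (nominalList A) (implList A')) A.init A'.init ↔
      MaskingLE A.toPTS A'.toPTS := by
  rw [relOf_winning_iff, maskingLE_iff]
  rfl

theorem exists_losing_eq : ∃ l : List (Fin A.n × Fin A'.n),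
    enc (losing (nominalList A) (implList A')) = pairsVal l ∧
    ∀ s s', (s, s') ∈ l ↔ SymVertex.ref s s' ∈ symUSet A.toPTS A'.toPTS := by
  -- All integers in the output are sources of transitions, hence codes of states.
  have h : losing (nominalList A) (implList A') ∈ Set.range (List.map
      fun q : Fin A.n × Fin A'.n => (code q.1, code q.2)) := by
    rw [Set.range_list_map]
    intro p hp
    obtain ⟨h₁, h₂⟩ := List.mem_product.1 (List.mem_filter.1 hp).1
    simp only [nominalList, implList, List.map_map, List.mem_map] at h₁ h₂
    obtain ⟨τ, -, h₁⟩ := h₁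
    obtain ⟨τ', -, h₂⟩ := h₂
    exact ⟨(τ.1, τ'.1), Prod.ext h₁ h₂⟩
  obtain ⟨l, hl⟩ := h
  refine ⟨l, ?_, fun s s' => ?_⟩
  · rw [← hl]
    change Val.ofList _ = Val.ofList _
    rw [List.map_map]
    rfl
  · have h₁ : (s, s') ∈ l ↔ (code s, code s') ∈ losing (nominalList A) (implList A') := by
      rw [← hl, List.mem_map]
      constructor
      · exact fun h => ⟨_, h, rfl⟩
      · rintro ⟨⟨t, t'⟩, ht, h⟩
        rw [Prod.mk.injEq, code_injective.eq_iff, code_injective.eq_iff] at h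
        rwa [← h.1, ← h.2]
    rw [h₁, losing, List.mem_filter, ← not_iff_not, ← relOf_winning_iff_not_mem]
    have := relOf_statePairs A A' s s'
    rw [relOf, memPair_iff] at this
    simp [this, relOf]

/-! ### The size of the input -/

theorem esize_natCast_le (n : ℕ) : esize (n : ℤ) ≤ n + 1 := by
  rw [esize_int, Int.natAbs_natCast]
  exact Nat.succ_le_succ (Nat.size_le.2 Nat.lt_two_pow_self)

/-- By seriality. It controls the number of states and the initial state, which `transSize` does not
count. -/
theorem n_le_length {L : Type} (D : FinPTS L) : D.n ≤ D.trans.length := by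
  classical
  have h : (Finset.univ : Finset (Fin D.n)) ⊆ (D.trans.map fun τ => τ.1).toFinset := by
    intro s _
    obtain ⟨τ, hτ, rfl⟩ := D.serial s
    exact List.mem_toFinset.2 (List.mem_map.2 ⟨τ, hτ, rfl⟩)
  have := (Finset.card_le_card h).trans (List.toFinset_card_le _)
  simpa using this

theorem esize_input_le : esize (input A A') + 2 ≤
    16 * (A.transSize actionVal * A'.transSize labelVal) := by
  have h₁ : esize (nominalList A) = A.transSize actionVal := congrArg Val.size (enc_nominalList A)
  have h₂ : esize (implList A') = A'.transSize labelVal := congrArg Val.size (enc_implList A')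
  have h₃ : A.n ≤ esize (nominalList A) := by
    refine (n_le_length A).trans (le_trans ?_ (length_le_esize _))
    rw [nominalList, List.length_map]
  have h₄ : A'.n ≤ esize (implList A') := by
    refine (n_le_length A').trans (le_trans ?_ (length_le_esize _))
    rw [implList, List.length_map]
  have h₅ := esize_natCast_le A.n
  have h₆ := esize_natCast_le A'.n
  have h₇ : esize (code A.init) ≤ A.init + 1 := esize_natCast_le _
  have h₈ : esize (code A'.init) ≤ A'.init + 1 := esize_natCast_le _
  have h₉ := A.init.2
  have h₁₀ := A'.init.2
  rw [input, esize_mk, esize_mk, esize_mk, esize_mk, esize_mk, ← h₁, ← h₂]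
  have p₁ := esize_pos (nominalList A)
  have p₂ := esize_pos (implList A')
  -- The left side is at most `3 * m + 3 * m' + 9` for the two transition sizes, and `m + m' ≤ m *
  -- m' + 1` since both are positive; this stays below `16 * (m * m')`.
  nlinarith

end Correctness
end PMask

theorem mainTheorem2 :
    ∃ (decider computeU : PMask.Code) (P : Polynomial ℕ),
      ∀ (A : PMask.FinPTS ℕ) (A' : PMask.FinPTS (ℕ ⊕ ℕ)),
        (∃ (b : Bool) (t : ℕ),
          decider.Run (PMask.inputVal A A') (PMask.Val.ofBool b) t ∧
          (b = true ↔ PMask.MaskingLE A.toPTS A'.toPTS) ∧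
          t ≤ P.eval (A.transSize PMask.actionVal * A'.transSize PMask.labelVal)) ∧
        (∃ (l : List (Fin A.n × Fin A'.n)) (t : ℕ),
          computeU.Run (PMask.inputVal A A') (PMask.pairsVal l) t ∧
          (∀ s s', (s, s') ∈ l ↔
            PMask.SymVertex.ref s s' ∈ PMask.symUSet A.toPTS A'.toPTS) ∧
          t ≤ P.eval (A.transSize PMask.actionVal * A'.transSize PMask.labelVal)) ∧
        (PMask.MaskingLE A.toPTS A'.toPTS ↔
          PMask.SymVertex.ref A.toPTS.init A'.toPTS.init ∉
            PMask.symUSet A.toPTS A'.toPTS) := by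
  have hT : PMask.PolyTime fun x : PMask.Input => (x.1.2.2, x.2.2.2) :=
    (.mk (.snd (.snd (.fst .id))) (.snd (.snd (.snd .id))))
  have hdec : PMask.PolyTime fun x : PMask.Input =>
      PMask.memPair (PMask.winning x.1.2.2 x.2.2.2) x.1.2.1 x.2.2.1 :=
    (PMask.PolyTime.winning.comp hT).memPair (.fst (.snd (.fst .id))) (.fst (.snd (.snd .id)))
  have hU : PMask.PolyTime fun x : PMask.Input => PMask.losing x.1.2.2 x.2.2.2 :=
    PMask.PolyTime.losing.comp hT
  obtain ⟨decider, φ, ⟨k, hk⟩, hdec⟩ := hdec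
  obtain ⟨computeU, ψ, ⟨l, hl⟩, hU⟩ := hU
  -- The time bounds are powers of `esize (input A A') + 2`, which `esize_input_le` replaces by `16
  -- * (m * m')`. The sum serves both programs.
  refine ⟨decider, computeU, (16 * Polynomial.X) ^ k + (16 * Polynomial.X) ^ l, fun A A' => ?_⟩
  obtain ⟨t, ht, hr⟩ := hdec (PMask.input A A')
  obtain ⟨t', ht', hr'⟩ := hU (PMask.input A A')
  rw [PMask.enc_input] at hr hr'
  obtain ⟨L, hL, hmem⟩ := PMask.exists_losing_eq A A'
  have hk := (hk (PMask.input A A')).trans (Nat.pow_le_pow_left (PMask.esize_input_le A A') k)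
  have hl := (hl (PMask.input A A')).trans (Nat.pow_le_pow_left (PMask.esize_input_le A A') l)
  have hP : ∀ n : ℕ, ((16 * Polynomial.X) ^ k + (16 * Polynomial.X) ^ l : Polynomial ℕ).eval n =
      (16 * n) ^ k + (16 * n) ^ l := by
    intro n
    simp
  refine ⟨⟨_, t, hr, PMask.relOf_winning_init_iff A A', by rw [hP]; omega⟩,
    ⟨L, t', hL ▸ hr', hmem, by rw [hP]; omega⟩, ?_⟩
  rw [← PMask.relOf_winning_init_iff]
  exact PMask.relOf_winning_iff_not_mem A A' _ _
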